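/- **Theorem (positive Kwapień factorization).** Let $m\ge 1$, let $E_1,\dots,E_m,F$ be (real) Banach lattices, and let $1\le p,r,p_1,\dots,p_m\le\infty$ satisfy $\frac1p=\frac1{p_1}+\dots+\frac1{p_m}+\frac1r$; let $r^*$ be the conjugate exponent of $r$. For a finite family $(x_i)_{i=1}^n$ in a Banach space $X$ put $\|(x_i)\|_s=(\sum_i\|x_i\|^s)^{1/s}$ (the maximum if $s=\infty$) and $\|(x_i)\|_{s,w}=\sup_{\|x^*\|_{X^*}\le1}\|(\langle x^*,x_i\rangle)_i\|_s$. Write $E^+$ for the positive cone of a Banach lattice $E$, and $E^{*+}$ for the cone of positive functionals in $E^*$. * A bounded $m$-linear map $T:E_1\times\dots\times E_m\to F$ is *positive $(p_1,\dots,p_m;r)$-dominated* if there is $C>0$ such that for all $n$, all $x_1^j,\dots,x_n^j\in E_j^+$ $(1\le j\le m)$ and $y_1^*,\dots,y_n^*\in F^{*+}$, $$\big\|\big(\langle T(x_i^1,\dots,x_i^m),y_i^*\rangle\big)_i\big\|_p\le C\prod_{j=1}^m\|(x_i^j)_i\|_{p_j,w}\,\|(y_i^*)_i\|_{r,w};$$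 $d^+_{(p_1,\dots,p_m;r)}(T)$ is the infimum of such $C$. * For a Banach lattice $E$, a Banach space $X$ and $1\le s\le\infty$, a bounded linear $R:E\to X$ is *positive $s$-summing* if there is $C>0$ such that $\|(Rx_i)_i\|_s\le C\|(x_i)_i\|_{s,w}$ for all finite families $(x_i)$ in $E^+$; $\pi_s^+(R)$ is the infimum of such $C$. * For Banach spaces $X_1,\dots,X_m$ and $1\le s\le\infty$ with conjugate exponent $s^*$, a bounded $m$-linear $S:X_1\times\dots\times X_m\to F$ is *Cohen positive strongly $s$-summing* if there is $C>0$ such that for all $n$, all $x_i^j\in X_j$ and $y_i^*\in F^{*+}$ $(1\le i\le n,\ 1\le j\le m)$, $$\sum_{i=1}^n|\langle S(x_i^1,\dots,x_i^m),y_i^*\rangle|\le C\,\Big\|\Big(\prod_{j=1}^m\|x_i^j\|\Big)_i\Big\|_s\,\|(y_i^*)_i\|_{s^*,w};$$ $d_s^{m+}(S)$ is the infimum of such $C$. Then a bounded $m$-linear map $T:E_1\times\dots\times E_m\to F$ is positive $(p_1,\dots,p_m;r)$-dominated if and only if there exist Banach spaces $X_1,\dots,X_m$, positive $p_j$-summing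 operators $R_j:E_j\to X_j$ $(1\le j\le m)$ and a Cohen positive strongly $r^*$-summing multilinear operator $S:X_1\times\dots\times X_m\to F$ with $T=S\circ(R_1,\dots,R_m)$. Moreover, in this case, $$d^+_{(p_1,\dots,p_m;r)}(T)=\inf\Big\{d_{r^*}^{m+}(S)\prod_{j=1}^m\pi_{p_j}^+(R_j)\Big\},$$ the infimum being taken over all such factorizations $T=S\circ(R_1,\dots,R_m)$ through Banach spaces $X_1,\dots,X_m$. -/

import Mathlib

universe u v w

namespace PositiveOperators

noncomputable section

/-- The strong `ℓ_p^n`-norm `(∑ ‖x_i‖^p)^{1/p}` of a finite family in a normed space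
(`max ‖x_i‖` for `p = ∞`). -/
def strongNorm {X : Type*} [NormedAddCommGroup X] {n : ℕ} (p : ENNReal) (x : Fin n → X) : ℝ :=
  ‖(WithLp.toLp p x : PiLp p (fun _ : Fin n => X))‖

/-- The weak `ℓ_p^n`-norm of a finite family in a normed space: the supremum of
`‖(⟨φ, x_i⟩)_i‖_p` over the closed unit ball of the dual space. -/
def weakNorm {X : Type*} [NormedAddCommGroup X] [NormedSpace ℝ X] {n : ℕ}
    (p : ENNReal) (x : Fin n → X) : ℝ :=
  ⨆ φ : {φ : StrongDual ℝ X // ‖φ‖ ≤ 1}, strongNorm p (fun i => φ.1 (x i))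

/-- The positive cone of the dual of a Banach lattice. -/
def dualCone (F : Type*) [NormedAddCommGroup F] [NormedSpace ℝ F] [Lattice F] :
    Set (StrongDual ℝ F) :=
  {φ | ∀ x : F, 0 ≤ x → 0 ≤ φ x}

section Linear

variable {E : Type*} [NormedAddCommGroup E] [NormedSpace ℝ E] [Lattice E]
  {X : Type*} [NormedAddCommGroup X] [NormedSpace ℝ X]

/-- `C` is an admissible constant in the definition of positive `p`-summing operators. -/
def PosSummingBound (p : ENNReal) (R : E →L[ℝ] X) (C : ℝ) : Prop :=
  ∀ (n : ℕ) (x : Fin n → E), (∀ i, 0 ≤ x i) →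
    strongNorm p (fun i => R (x i)) ≤ C * weakNorm p x

/-- Positive `p`-summing operators. -/
def IsPosSumming (p : ENNReal) (R : E →L[ℝ] X) : Prop :=
  ∃ C : ℝ, 0 < C ∧ PosSummingBound p R C

/-- The norm `π_p^+`. -/
def posSummingNorm (p : ENNReal) (R : E →L[ℝ] X) : ℝ :=
  sInf {C : ℝ | 0 < C ∧ PosSummingBound p R C}

end Linear

section Multilinear

variable {m : ℕ} {X : Fin m → Type*} [∀ j, NormedAddCommGroup (X j)] [∀ j, NormedSpace ℝ (X j)]
  {F : Type*} [NormedAddCommGroup F] [NormedSpace ℝ F] [Lattice F]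

/-- `C` is an admissible constant in the definition of Cohen positive strongly `p`-summing
multilinear operators; `p.conjExponent` is the conjugate exponent `p^*` (with `1^* = ∞` and
`∞^* = 1`). -/
def CohenPosBound (p : ENNReal) (S : ContinuousMultilinearMap ℝ X F) (C : ℝ) : Prop :=
  ∀ (n : ℕ) (x : Fin n → ∀ j, X j) (y : Fin n → StrongDual ℝ F), (∀ i, y i ∈ dualCone F) →
    ∑ i, |y i (S (x i))| ≤
      C * strongNorm p (fun i => ∏ j, ‖x i j‖) * weakNorm p.conjExponent y

/-- Cohen positive strongly `p`-summing multilinear operators. -/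
def IsCohenPosSumming (p : ENNReal) (S : ContinuousMultilinearMap ℝ X F) : Prop :=
  ∃ C : ℝ, 0 < C ∧ CohenPosBound p S C

/-- The norm `d_p^{m+}`. -/
def cohenPosNorm (p : ENNReal) (S : ContinuousMultilinearMap ℝ X F) : ℝ :=
  sInf {C : ℝ | 0 < C ∧ CohenPosBound p S C}

end Multilinear

section Dominated

variable {m : ℕ} {E : Fin m → Type*} [∀ j, NormedAddCommGroup (E j)] [∀ j, NormedSpace ℝ (E j)]
  [∀ j, Lattice (E j)]
  {F : Type*} [NormedAddCommGroup F] [NormedSpace ℝ F] [Lattice F]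

/-- `C` is an admissible constant in the definition of positive `(p_1,…,p_m;r)`-dominated
multilinear operators, where `1/p = 1/p_1 + ⋯ + 1/p_m + 1/r`. -/
def PosDominatedBound (p : ENNReal) (q : Fin m → ENNReal) (r : ENNReal)
    (T : ContinuousMultilinearMap ℝ E F) (C : ℝ) : Prop :=
  ∀ (n : ℕ) (x : Fin n → ∀ j, E j) (y : Fin n → StrongDual ℝ F),
    (∀ i j, 0 ≤ x i j) → (∀ i, y i ∈ dualCone F) →
      strongNorm p (fun i => y i (T (x i))) ≤
        C * (∏ j, weakNorm (q j) (fun i => x i j)) * weakNorm r y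

/-- Positive `(p_1,…,p_m;r)`-dominated multilinear operators. -/
def IsPosDominated (p : ENNReal) (q : Fin m → ENNReal) (r : ENNReal)
    (T : ContinuousMultilinearMap ℝ E F) : Prop :=
  ∃ C : ℝ, 0 < C ∧ PosDominatedBound p q r T C

/-- The norm `d^+_{(p_1,…,p_m;r)}`. -/
def posDominatedNorm (p : ENNReal) (q : Fin m → ENNReal) (r : ENNReal)
    (T : ContinuousMultilinearMap ℝ E F) : ℝ :=
  sInf {C : ℝ | 0 < C ∧ PosDominatedBound p q r T C}

/-- `T = S ∘ (R_1,…,R_m)` with every `R_j` positive `p_j`-summing and `S` Cohen positive strongly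
`r^*`-summing. -/
def IsKwapienFactorization {X : Fin m → Type*} [∀ j, NormedAddCommGroup (X j)]
    [∀ j, NormedSpace ℝ (X j)] (q : Fin m → ENNReal) (r : ENNReal)
    (T : ContinuousMultilinearMap ℝ E F) (R : ∀ j, E j →L[ℝ] X j)
    (S : ContinuousMultilinearMap ℝ X F) : Prop :=
  (∀ j, IsPosSumming (q j) (R j)) ∧ IsCohenPosSumming r.conjExponent S ∧
    T = S.compContinuousLinearMap R

end Dominated

end

end PositiveOperators

/-! Sufficiency is Hölder's inequality. Pairing the left-hand side with a dual sequence in `ℓ_{p*}`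
and moving that sequence into one argument of `S`, the identity `1/r* = 1/p* + ∑ 1/p_j` lets the
Cohen bound for `S` and the summing bounds for the `R_j` multiply (`posDominatedBound_comp`).

Necessity rests on a Pietsch-type domination (`exists_dominating_seminorms`): there are seminorms
`N_j` and `M`, whose strong sums are controlled by weak norms, with `|y (T x)| ≤ C ∏ N_j (x_j) M y`
for positive `x_j` and `y`. Instead of probability measures on dual balls, the proof uses the
compact convex set `powerClass` of `q`-th powers of such seminorms, together with a Ky Fan
separation argument.

The estimate holds only on cones, so `E_j` normed by `N_j` cannot serve as `X_j`. The right norm on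
`E_j` is the supremum of `|L x|` over the functionals `L` bounded by `N_j` on the cone
(`exists_factor_space`). A functional bounded by `c N_j` on the cone is then bounded by `c ‖R_j x‖`
everywhere, so positivity can be dropped one variable at a time with no loss in `C`
(`abs_apply_le_prod_norm`). Hence `T` factors through the `R_j` (`exists_multilinear_factor`), each
`R_j` has summing constant 1 and `S` has Cohen constant `C`, which also gives the equality of norms.
-/

namespace PositiveOperators

open scoped ENNReal
open MeasureTheory Filter Topology

/-! ### Strong and weak norms of finite families; Hölder and duality. -/

section Norms

variable {X : Type*} [NormedAddCommGroup X] {n : ℕ} {p : ℝ≥0∞}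

theorem strongNorm_top (x : Fin n → X) : strongNorm ∞ x = ⨆ i, ‖x i‖ := rfl

theorem strongNorm_eq_sum (hp : 0 < p.toReal) (x : Fin n → X) :
    strongNorm p x = (∑ i, ‖x i‖ ^ p.toReal) ^ (1 / p.toReal) :=
  PiLp.norm_eq_sum hp _

theorem strongNorm_one (x : Fin n → X) : strongNorm 1 x = ∑ i, ‖x i‖ := by
  rw [strongNorm_eq_sum (by simp)]
  simp

theorem strongNorm_nonneg (hp : p ≠ 0) (x : Fin n → X) : 0 ≤ strongNorm p x := by
  rcases eq_or_ne p ∞ with rfl | h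
  · exact Real.iSup_nonneg fun i => norm_nonneg _
  · rw [strongNorm_eq_sum (ENNReal.toReal_pos hp h)]
    positivity

theorem strongNorm_mono {Y : Type*} [NormedAddCommGroup Y] (hp : p ≠ 0) {x : Fin n → X}
    {y : Fin n → Y} (h : ∀ i, ‖x i‖ ≤ ‖y i‖) : strongNorm p x ≤ strongNorm p y := by
  rcases eq_or_ne p ∞ with rfl | hpt
  · exact ciSup_mono (Set.finite_range _).bddAbove h
  · have h0 := ENNReal.toReal_pos hp hpt
    rw [strongNorm_eq_sum h0, strongNorm_eq_sum h0]
    gcongr with i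
    exact h i

theorem strongNorm_norm (hp : p ≠ 0) (x : Fin n → X) :
    strongNorm p (fun i => ‖x i‖) = strongNorm p x :=
  le_antisymm (strongNorm_mono hp (by simp)) (strongNorm_mono hp (by simp))

theorem norm_le_strongNorm (hp : p ≠ 0) (x : Fin n → X) (i : Fin n) : ‖x i‖ ≤ strongNorm p x := by
  rcases eq_or_ne p ∞ with rfl | h
  · exact le_ciSup (f := fun i => ‖x i‖) (Set.finite_range _).bddAbove i
  · have h0 := ENNReal.toReal_pos hp h
    rw [strongNorm_eq_sum h0, one_div, Real.le_rpow_inv_iff_of_pos (norm_nonneg _)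
      (by positivity) h0]
    exact Finset.single_le_sum (f := fun i => ‖x i‖ ^ p.toReal) (fun i _ => by positivity)
      (Finset.mem_univ i)

theorem strongNorm_fin_one (hp : p ≠ 0) (x : X) : strongNorm p (fun _ : Fin 1 => x) = ‖x‖ := by
  rcases eq_or_ne p ∞ with rfl | h
  · simp [strongNorm_top]
  · have h0 := ENNReal.toReal_pos hp h
    rw [strongNorm_eq_sum h0]
    simp [Real.rpow_rpow_inv (norm_nonneg x) h0.ne']

/-- Passing to counting measure makes Hölder's inequality available for all exponents at once, `∞`
included. -/
theorem toReal_eLpNorm_count (hp : p ≠ 0) (x : Fin n → X) :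
    (eLpNorm x p Measure.count).toReal = strongNorm p x := by
  rcases eq_or_ne p ∞ with rfl | h
  · rw [eLpNorm_exponent_top, eLpNormEssSup_count, strongNorm_top, ENNReal.toReal_iSup (by simp)]
    simp
  · rw [eLpNorm_eq_lintegral_rpow_enorm_toReal hp h, lintegral_count,
      strongNorm_eq_sum (ENNReal.toReal_pos hp h), ← ENNReal.toReal_rpow, tsum_fintype,
      ENNReal.toReal_sum (by simp)]
    simp [← ENNReal.toReal_rpow]

/-- Hölder's inequality for two finite families of reals. -/
theorem strongNorm_mul_le {p q s : ℝ≥0∞} (hp : p ≠ 0) (hq : q ≠ 0) (hs : s ≠ 0)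
    (h : s⁻¹ = p⁻¹ + q⁻¹) (a b : Fin n → ℝ) :
    strongNorm s (fun i => a i * b i) ≤ strongNorm p a * strongNorm q b := by
  rw [← toReal_eLpNorm_count hp, ← toReal_eLpNorm_count hq, ← toReal_eLpNorm_count hs,
    ← ENNReal.toReal_mul]
  have : ENNReal.HolderTriple p q s := ⟨h.symm⟩
  refine ENNReal.toReal_mono (ENNReal.mul_ne_top ?_ ?_)
    (eLpNorm_smul_le_mul_eLpNorm (f := b) (φ := a) (measurable_of_finite _).aestronglyMeasurable
      (measurable_of_finite _).aestronglyMeasurable)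
  all_goals exact (eLpNorm_count_lt_top_of_lt fun i => enorm_lt_top).ne

/-- Hölder's inequality for finitely many finite families of reals. -/
theorem strongNorm_prod_le {ι : Type*} (t : Finset ι) (q : ι → ℝ≥0∞) (hq : ∀ j ∈ t, 1 ≤ q j)
    (a : ι → Fin n → ℝ) :
    strongNorm (∑ j ∈ t, (q j)⁻¹)⁻¹ (fun i => ∏ j ∈ t, a j i) ≤
      ∏ j ∈ t, strongNorm (q j) (a j) := by
  classical
  induction t using Finset.induction_on with
  | empty =>
    simp only [Finset.sum_empty, ENNReal.inv_zero, Finset.prod_empty, strongNorm_top]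
    exact Real.iSup_le (by simp) zero_le_one
  | insert j t hj ih =>
    have h0 : ∀ s ⊆ insert j t, (∑ j ∈ s, (q j)⁻¹)⁻¹ ≠ 0 := fun s hs => by
      rw [ne_eq, ENNReal.inv_eq_zero, ← ne_eq, ENNReal.sum_ne_top]
      intro k hk
      rw [ne_eq, ENNReal.inv_eq_top]
      exact (zero_lt_one.trans_le (hq k (hs hk))).ne'
    have hqj : q j ≠ 0 := (zero_lt_one.trans_le (hq j (Finset.mem_insert_self j t))).ne'
    simp only [Finset.prod_insert hj]
    refine (strongNorm_mul_le hqj (h0 t (Finset.subset_insert j t)) (h0 _ subset_rfl) ?_ _ _).trans ?_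
    · simp [Finset.sum_insert hj]
    · exact mul_le_mul_of_nonneg_left (ih fun k hk => hq k (Finset.mem_insert_of_mem hk))
        (strongNorm_nonneg hqj _)

/-- The `ℓ_p` norm of a finite family of nonnegative reals is attained by duality. -/
theorem exists_dual_strongNorm {p p' : ℝ≥0∞} [h : p.HolderConjugate p'] (a : Fin n → ℝ)
    (ha : ∀ i, 0 ≤ a i) :
    ∃ l : Fin n → ℝ, (∀ i, 0 ≤ l i) ∧ strongNorm p' l ≤ 1 ∧ strongNorm p a ≤ ∑ i, l i * a i := by
  rcases eq_or_ne p ∞ with rfl | hp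
  · obtain rfl : p' = 1 := ENNReal.HolderConjugate.unique ∞ p' 1
    rcases isEmpty_or_nonempty (Fin n) with hn | hn
    · exact ⟨0, by simp, by simp [strongNorm_one], by simp [strongNorm_top]⟩
    · obtain ⟨k, hk⟩ := exists_eq_ciSup_of_finite (f := fun i => ‖a i‖)
      refine ⟨Pi.single k 1, fun i => ?_, ?_, ?_⟩
      · rw [Pi.single_apply]
        split_ifs <;> simp
      · simp [strongNorm_one, Pi.single_apply, apply_ite norm]
      · rw [strongNorm_top, ← hk]
        simp [Pi.single_apply, Real.norm_of_nonneg (ha k)]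
  rcases eq_or_ne p' ∞ with rfl | hp'
  · have := h.symm
    obtain rfl : p = 1 := ENNReal.HolderConjugate.unique ∞ p 1
    refine ⟨1, by simp, Real.iSup_le (by simp) zero_le_one, ?_⟩
    simp [strongNorm_one, abs_of_nonneg (ha _)]
  · have hpq := ENNReal.HolderConjugate.toReal_of_ne_top hp hp'
    obtain ⟨g, hg, hgs⟩ := (NNReal.isGreatest_Lp Finset.univ (fun i => (a i).toNNReal) hpq).1
    refine ⟨fun i => g i, fun i => (g i).2, ?_, ?_⟩
    · rw [strongNorm_eq_sum hpq.symm.pos]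
      refine Real.rpow_le_one (by positivity) ?_ (by positivity)
      simpa using (NNReal.coe_le_coe.2 hg)
    · rw [strongNorm_eq_sum hpq.pos]
      have := congrArg NNReal.toReal hgs
      push_cast at this
      simp only [Real.coe_toNNReal _ (ha _)] at this
      simp only [Real.norm_of_nonneg (ha _), ← this]
      exact (Finset.sum_congr rfl fun i _ => mul_comm _ _).le

variable [NormedSpace ℝ X]

theorem bddAbove_weakNorm (hp : p ≠ 0) (x : Fin n → X) :
    BddAbove (Set.range fun φ : {φ : StrongDual ℝ X // ‖φ‖ ≤ 1} =>
      strongNorm p (fun i => φ.1 (x i))) := by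
  refine ⟨strongNorm p x, ?_⟩
  rintro _ ⟨φ, rfl⟩
  exact strongNorm_mono hp fun i => φ.1.le_of_opNorm_le φ.2 (x i) |>.trans (one_mul _).le

theorem strongNorm_le_weakNorm (hp : p ≠ 0) (x : Fin n → X) {φ : StrongDual ℝ X} (hφ : ‖φ‖ ≤ 1) :
    strongNorm p (fun i => φ (x i)) ≤ weakNorm p x :=
  le_ciSup (bddAbove_weakNorm hp x) ⟨φ, hφ⟩

theorem weakNorm_nonneg (hp : p ≠ 0) (x : Fin n → X) : 0 ≤ weakNorm p x :=
  Real.iSup_nonneg fun _ => strongNorm_nonneg hp _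

theorem weakNorm_le {x : Fin n → X} {B : ℝ}
    (h : ∀ φ : StrongDual ℝ X, ‖φ‖ ≤ 1 → strongNorm p (fun i => φ (x i)) ≤ B) :
    weakNorm p x ≤ B :=
  haveI : Nonempty {φ : StrongDual ℝ X // ‖φ‖ ≤ 1} := ⟨⟨0, by simp⟩⟩
  ciSup_le fun φ => h φ.1 φ.2

theorem weakNorm_le_strongNorm (hp : p ≠ 0) (x : Fin n → X) : weakNorm p x ≤ strongNorm p x :=
  weakNorm_le fun φ hφ => strongNorm_mono hp fun i => φ.le_of_opNorm_le hφ (x i) |>.trans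
    (one_mul _).le

theorem weakNorm_fin_one_le (hp : p ≠ 0) (x : X) : weakNorm p (fun _ : Fin 1 => x) ≤ ‖x‖ :=
  (weakNorm_le_strongNorm hp _).trans_eq (strongNorm_fin_one hp x)

/-- Each `x i` has a norming functional. Thus at exponent `∞` the norm itself can serve as the
dominating seminorm. -/
theorem strongNorm_top_le_weakNorm (x : Fin n → X) : strongNorm ∞ x ≤ weakNorm ∞ x := by
  refine Real.iSup_le (fun i => ?_) (weakNorm_nonneg ENNReal.top_ne_zero x)
  obtain ⟨φ, hφ, hx⟩ := exists_dual_vector'' ℝ (x i)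
  calc ‖x i‖ = ‖φ (x i)‖ := by rw [hx]; simp
    _ ≤ _ := norm_le_strongNorm (p := ∞) ENNReal.top_ne_zero (fun i => φ (x i)) i
    _ ≤ _ := strongNorm_le_weakNorm ENNReal.top_ne_zero x hφ

end Norms

/-! ### Ky Fan's lemma by separation in finite dimensions. -/

section Minimax

/-- Ky Fan's lemma for evaluations: if every finite nonnegative combination of the inequalities
`H ω ≤ f ω` can be solved in a compact convex set of functions, then all of them can be solved
simultaneously. -/
theorem exists_forall_le_of_weighted {Ω : Type*} {K : Set (Ω → ℝ)} (hK : IsCompact K)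
    (hKc : Convex ℝ K) (H : Ω → ℝ)
    (h : ∀ (n : ℕ) (ω : Fin n → Ω) (w : Fin n → ℝ), (∀ i, 0 ≤ w i) →
      ∃ f ∈ K, ∑ i, w i * H (ω i) ≤ ∑ i, w i * f (ω i)) :
    ∃ f ∈ K, ∀ ω, H ω ≤ f ω := by
  classical
  suffices hs : (K ∩ ⋂ ω, {f : Ω → ℝ | H ω ≤ f ω}).Nonempty by
    obtain ⟨f, hf, hf'⟩ := hs
    exact ⟨f, hf, fun ω => Set.mem_iInter.1 hf' ω⟩
  -- By compactness finitely many evaluations suffice. If they had no common solution, the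
  -- projection of `K` would miss the orthant above `H` and could be strictly separated from it.
  refine hK.inter_iInter_nonempty _
    (fun ω => isClosed_le continuous_const (continuous_apply ω)) fun u => ?_
  by_contra hne
  let e := u.equivFin
  let ρ : (Ω → ℝ) →ₗ[ℝ] (Fin u.card → ℝ) := LinearMap.funLeft ℝ ℝ fun i => (e.symm i : Ω)
  have hρc : Continuous ρ := continuous_pi fun i => continuous_apply _
  have hdisj : Disjoint (ρ '' K) (Set.Ici (ρ H)) := by
    rw [Set.disjoint_left]
    rintro _ ⟨f, hf, rfl⟩ hH
    refine hne ⟨f, hf, Set.mem_iInter₂.2 fun ω hω => ?_⟩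
    simpa [ρ, e] using hH (e ⟨ω, hω⟩)
  obtain ⟨φ, a, b, hφa, hab, hφb⟩ := geometric_hahn_banach_compact_closed (hKc.linear_image ρ)
    (hK.image hρc) (convex_Ici (ρ H)) isClosed_Ici hdisj
  have hsum : ∀ g, φ g = ∑ i, φ (Pi.single i 1) * g i := fun g => by
    rw [← ContinuousLinearMap.coe_coe, LinearMap.pi_apply_eq_sum_univ (φ : _ →ₗ[ℝ] ℝ) g]
    refine Finset.sum_congr rfl fun i _ => ?_
    rw [smul_eq_mul, mul_comm]
    congr 2
    ext j
    simp [Pi.single_apply, eq_comm]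
  -- The orthant is unbounded upwards: along a coordinate with negative coefficient, the chosen
  -- multiple would bring `φ` down to exactly `b`.
  have hw : ∀ i, 0 ≤ φ (Pi.single i 1) := fun i => by
    by_contra! hi
    have hH : b < φ (ρ H) := hφb _ Set.self_mem_Ici
    have ht : 0 ≤ (φ (ρ H) - b) / -φ (Pi.single i 1) := div_nonneg (by linarith) (by linarith)
    have := hφb (ρ H + ((φ (ρ H) - b) / -φ (Pi.single i 1)) • Pi.single i 1)
      (Set.mem_Ici.2 (le_add_of_nonneg_right
        (smul_nonneg ht (Pi.single_nonneg.2 (zero_le_one' ℝ)))))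
    rw [map_add, map_smul, smul_eq_mul, div_neg, neg_mul, div_mul_cancel₀ _ hi.ne] at this
    linarith
  obtain ⟨f, hf, hle⟩ := h _ (fun i => (e.symm i : Ω)) _ hw
  have h1 := hφa _ ⟨f, hf, rfl⟩
  have h2 := hφb _ (Set.self_mem_Ici (a := ρ H))
  rw [hsum] at h1 h2
  exact absurd hle (not_le.2 (h1.trans (hab.trans h2)))

end Minimax

/-! ### The compact convex class of powers of seminorms. -/

section PowerClass

variable {V : Type*} [NormedAddCommGroup V] [NormedSpace ℝ V] {q : ℝ≥0∞}

variable (V q) in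
/-- The `q`-th powers of the seminorms `N` on `V` whose strong `ℓ_q`-norms are bounded by weak
`ℓ_q`-norms. -/
def powerClass : Set (V → ℝ) :=
  {f | (∀ x, 0 ≤ f x) ∧ (∀ (t : ℝ) x, f (t • x) = |t| ^ q.toReal * f x) ∧
    (∀ (a b : ℝ) (x y : V), 0 ≤ a → 0 ≤ b → a + b = 1 → f (a • x + b • y) ≤ a * f x + b * f y) ∧
    ∀ (n : ℕ) (x : Fin n → V), ∑ i, f (x i) ≤ weakNorm q x ^ q.toReal}

theorem convex_powerClass : Convex ℝ (powerClass V q) := by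
  rintro f ⟨hf0, hft, hfc, hfs⟩ g ⟨hg0, hgt, hgc, hgs⟩ a b ha hb hab
  refine ⟨fun x => ?_, fun t x => ?_, fun c d x y hc hd hcd => ?_, fun n x => ?_⟩
  · exact add_nonneg (mul_nonneg ha (hf0 x)) (mul_nonneg hb (hg0 x))
  · simp only [Pi.add_apply, Pi.smul_apply, smul_eq_mul, hft, hgt]
    ring
  · simp only [Pi.add_apply, Pi.smul_apply, smul_eq_mul]
    have h1 := mul_le_mul_of_nonneg_left (hfc c d x y hc hd hcd) ha
    have h2 := mul_le_mul_of_nonneg_left (hgc c d x y hc hd hcd) hb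
    linarith
  · simp only [Pi.add_apply, Pi.smul_apply, smul_eq_mul, Finset.sum_add_distrib, ← Finset.mul_sum]
    have h1 := mul_le_mul_of_nonneg_left (hfs n x) ha
    have h2 := mul_le_mul_of_nonneg_left (hgs n x) hb
    calc _ ≤ (a + b) * weakNorm q x ^ q.toReal := by linarith
      _ = _ := by rw [hab, one_mul]

theorem isClosed_powerClass : IsClosed (powerClass V q) := by
  simp only [powerClass, Set.ofPred_and, Set.ofPred_forall]
  refine IsClosed.inter ?_ (IsClosed.inter ?_ (IsClosed.inter ?_ ?_))
  · exact isClosed_iInter fun x => isClosed_le (by fun_prop) (by fun_prop)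
  · exact isClosed_iInter fun t => isClosed_iInter fun x => isClosed_eq (by fun_prop) (by fun_prop)
  · refine isClosed_iInter fun a => isClosed_iInter fun b => isClosed_iInter fun x =>
      isClosed_iInter fun y => isClosed_iInter fun _ => isClosed_iInter fun _ =>
      isClosed_iInter fun _ => isClosed_le (by fun_prop) (by fun_prop)
  · exact isClosed_iInter fun n => isClosed_iInter fun x => isClosed_le (by fun_prop) (by fun_prop)

/-- Tychonoff: the bound for one-term families confines each value `f x` to a fixed interval. -/
theorem isCompact_powerClass : IsCompact (powerClass V q) := by
  refine (isCompact_univ_pi fun x : V => isCompact_Icc (a := (0 : ℝ))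
    (b := weakNorm q (fun _ : Fin 1 => x) ^ q.toReal)).of_isClosed_subset isClosed_powerClass ?_
  rintro f ⟨hf0, -, -, hfs⟩ x -
  exact ⟨hf0 x, by simpa using hfs 1 fun _ => x⟩

theorem zero_mem_powerClass (hq : q ≠ 0) : (0 : V → ℝ) ∈ powerClass V q :=
  ⟨by simp, by simp, by simp, fun n x => by
    simpa using Real.rpow_nonneg (weakNorm_nonneg hq x) _⟩

theorem abs_rpow_mem_powerClass (hq : 1 ≤ q) (hqt : q ≠ ∞) {φ : StrongDual ℝ V} (hφ : ‖φ‖ ≤ 1) :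
    (fun x => |φ x| ^ q.toReal) ∈ powerClass V q := by
  have hq0 : q ≠ 0 := (zero_lt_one.trans_le hq).ne'
  have h0 := ENNReal.toReal_pos hq0 hqt
  have h1 : 1 ≤ q.toReal := by simpa using ENNReal.toReal_mono hqt hq
  refine ⟨fun x => by positivity, fun t x => ?_, fun a b x y ha hb hab => ?_, fun n x => ?_⟩
  · simp [abs_mul, Real.mul_rpow]
  · calc |φ (a • x + b • y)| ^ q.toReal ≤ (a * |φ x| + b * |φ y|) ^ q.toReal := by
          gcongr
          simpa [abs_mul, abs_of_nonneg ha, abs_of_nonneg hb] using abs_add_le (a * φ x) (b * φ y)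
      _ ≤ _ := (convexOn_rpow h1).2 (abs_nonneg (φ x)) (abs_nonneg (φ y)) ha hb hab
  · have h := strongNorm_le_weakNorm hq0 x hφ
    rw [strongNorm_eq_sum h0, one_div,
      Real.rpow_inv_le_iff_of_pos (by positivity) (weakNorm_nonneg hq0 x) h0] at h
    exact h

/-- The weak norm of a finite family is attained in the power class. -/
theorem exists_mem_powerClass_weakNorm_le (hq : 1 ≤ q) (hqt : q ≠ ∞) {n : ℕ} (x : Fin n → V) :
    ∃ f ∈ powerClass V q, weakNorm q x ^ q.toReal ≤ ∑ i, f (x i) := by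
  have hq0 : q ≠ 0 := (zero_lt_one.trans_le hq).ne'
  have h0 := ENNReal.toReal_pos hq0 hqt
  -- A maximiser of the sum beats every `|φ|^q` with `‖φ‖ ≤ 1`, since these belong to the class.
  obtain ⟨f, hf, hmax⟩ := isCompact_powerClass.exists_isMaxOn ⟨_, zero_mem_powerClass hq0⟩
    (f := fun g : V → ℝ => ∑ i, g (x i)) (by fun_prop)
  have hs : 0 ≤ ∑ i, f (x i) := Finset.sum_nonneg fun i _ => hf.1 _
  refine ⟨f, hf, ?_⟩
  rw [← Real.le_rpow_inv_iff_of_pos (weakNorm_nonneg hq0 x) hs h0]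
  refine weakNorm_le fun φ hφ => ?_
  rw [strongNorm_eq_sum h0, one_div]
  exact Real.rpow_le_rpow (by positivity) (hmax (abs_rpow_mem_powerClass hq hqt hφ))
    (by positivity)

theorem powerClass_rpow_inv_smul {f : V → ℝ} (hf : f ∈ powerClass V q) (h0 : 0 < q.toReal) (t : ℝ)
    (x : V) : f (t • x) ^ q.toReal⁻¹ = ‖t‖ * f x ^ q.toReal⁻¹ := by
  rw [hf.2.1, Real.mul_rpow (by positivity) (hf.1 x), Real.rpow_rpow_inv (abs_nonneg t) h0.ne',
    Real.norm_eq_abs]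

theorem powerClass_inv_smul_le_one {f : V → ℝ} (hf : f ∈ powerClass V q) (h0 : 0 < q.toReal)
    {x : V} {r : ℝ} (hr : 0 < r) (h : f x ^ q.toReal⁻¹ ≤ r) : f (r⁻¹ • x) ≤ 1 := by
  have h1 : f (r⁻¹ • x) ^ q.toReal⁻¹ ≤ 1 := by
    rw [powerClass_rpow_inv_smul hf h0, norm_inv, Real.norm_of_nonneg hr.le]
    exact (inv_mul_le_one₀ hr).2 h
  rwa [Real.rpow_inv_le_iff_of_pos (hf.1 _) zero_le_one h0, Real.one_rpow] at h1

/-- Convexity of `f` makes `{f ≤ 1}` convex, and homogeneity of degree `q` makes `f^{1/q}` its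
gauge. The `ε` avoids dividing by zero where `f` vanishes. -/
theorem powerClass_rpow_inv_add_le {f : V → ℝ} (hf : f ∈ powerClass V q) (h0 : 0 < q.toReal)
    (x y : V) : f (x + y) ^ q.toReal⁻¹ ≤ f x ^ q.toReal⁻¹ + f y ^ q.toReal⁻¹ := by
  refine le_of_forall_pos_le_add fun ε hε => ?_
  have hN : ∀ x, 0 ≤ f x ^ q.toReal⁻¹ := fun x => Real.rpow_nonneg (hf.1 x) _
  set s := f x ^ q.toReal⁻¹ + ε / 2 with hs
  set t := f y ^ q.toReal⁻¹ + ε / 2 with ht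
  have hs0 : 0 < s := by have := hN x; positivity
  have ht0 : 0 < t := by have := hN y; positivity
  have key : f ((s + t)⁻¹ • (x + y)) ≤ 1 := by
    have h := hf.2.2.1 (s / (s + t)) (t / (s + t)) (s⁻¹ • x) (t⁻¹ • y) (by positivity)
      (by positivity) (by field_simp)
    have e : (s / (s + t)) • s⁻¹ • x + (t / (s + t)) • t⁻¹ • y = (s + t)⁻¹ • (x + y) := by
      rw [smul_smul, smul_smul, smul_add]
      congr 2 <;> field_simp
    rw [e] at h
    refine h.trans ?_
    have h1 := powerClass_inv_smul_le_one hf h0 hs0 (x := x) (by linarith)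
    have h2 := powerClass_inv_smul_le_one hf h0 ht0 (x := y) (by linarith)
    calc _ ≤ s / (s + t) * 1 + t / (s + t) * 1 := by gcongr
      _ = 1 := by field_simp
  have h2 : f ((s + t)⁻¹ • (x + y)) ^ q.toReal⁻¹ ≤ 1 :=
    Real.rpow_le_one (hf.1 _) key (by positivity)
  rw [powerClass_rpow_inv_smul hf h0, norm_inv, Real.norm_of_nonneg (by positivity),
    inv_mul_le_iff₀ (by positivity)] at h2
  linarith

/-- The strong `ℓ_q`-norms of families with respect to the seminorm `N` are bounded by weak
`ℓ_q`-norms. -/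
def WeaklyBounded (q : ℝ≥0∞) (N : Seminorm ℝ V) : Prop :=
  ∀ (n : ℕ) (x : Fin n → V), strongNorm q (fun i => N (x i)) ≤ weakNorm q x

theorem weaklyBounded_normSeminorm : WeaklyBounded ∞ (normSeminorm ℝ V) := fun _ x =>
  (strongNorm_norm ENNReal.top_ne_zero x).trans_le (strongNorm_top_le_weakNorm x)

theorem WeaklyBounded.le_norm {N : Seminorm ℝ V} (hN : WeaklyBounded q N) (hq : q ≠ 0) (x : V) :
    N x ≤ ‖x‖ := by
  have h := (hN 1 fun _ => x).trans (weakNorm_le_strongNorm hq _)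
  rwa [strongNorm_fin_one hq, strongNorm_fin_one hq, Real.norm_of_nonneg (apply_nonneg N x)] at h

/-- For finite `q` the seminorm is `f^{1/q}`. For `q = ∞` it is the norm, and `f ≤ 1` is automatic
because `∞.toReal = 0` turns the bound in the class into `weakNorm ^ 0 = 1`. -/
theorem exists_seminorm_of_mem_powerClass (hq : 1 ≤ q) {f : V → ℝ} (hf : f ∈ powerClass V q) :
    ∃ N : Seminorm ℝ V, WeaklyBounded q N ∧ ∀ (x : V) (r : ℝ), 0 < r → N x ≤ r →
      f (r⁻¹ • x) ≤ 1 ∧ (q = ∞ → ‖r⁻¹ • x‖ ≤ 1) := by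
  rcases eq_or_ne q ∞ with rfl | hqt
  · refine ⟨normSeminorm ℝ V, weaklyBounded_normSeminorm, fun x r hr hx => ⟨?_, fun _ => ?_⟩⟩
    · simpa using hf.2.2.2 1 fun _ => r⁻¹ • x
    · rw [norm_smul, norm_inv, Real.norm_of_nonneg hr.le]
      exact (inv_mul_le_one₀ hr).2 hx
  · have hq0 : q ≠ 0 := (zero_lt_one.trans_le hq).ne'
    have h0 := ENNReal.toReal_pos hq0 hqt
    refine ⟨Seminorm.of (fun x => f x ^ q.toReal⁻¹) (powerClass_rpow_inv_add_le hf h0)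
      (powerClass_rpow_inv_smul hf h0), fun n x => ?_, fun x r hr hx =>
        ⟨powerClass_inv_smul_le_one hf h0 hr hx, fun h => absurd h hqt⟩⟩
    rw [strongNorm_eq_sum h0, one_div,
      Real.rpow_inv_le_iff_of_pos (by positivity) (weakNorm_nonneg hq0 x) h0]
    refine le_trans (Finset.sum_le_sum fun i _ => le_of_eq ?_) (hf.2.2.2 n x)
    change ‖f (x i) ^ q.toReal⁻¹‖ ^ q.toReal = f (x i)
    rw [Real.norm_of_nonneg (Real.rpow_nonneg (hf.1 _) _), Real.rpow_inv_rpow (hf.1 _) h0.ne']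

/-- The weak norm of a weighted finite family is controlled by a member of the power class. -/
theorem exists_mem_powerClass_weighted (hq : 1 ≤ q) {n : ℕ} (x : Fin n → V)
    (hx : q = ∞ → ∀ i, ‖x i‖ ≤ 1) {w : Fin n → ℝ} (hw : ∀ i, 0 ≤ w i) :
    ∃ f ∈ powerClass V q, weakNorm q (fun i => w i ^ q.toReal⁻¹ • x i) ≤
      (∑ i, w i * f (x i)) ^ q.toReal⁻¹ := by
  have hq0 : q ≠ 0 := (zero_lt_one.trans_le hq).ne'
  rcases eq_or_ne q ∞ with rfl | hqt
  · refine ⟨0, zero_mem_powerClass hq0, (weakNorm_le_strongNorm hq0 _).trans ?_⟩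
    -- At `q = ∞` the exponent `q.toReal⁻¹` is `0`: the weights disappear and the right-hand side is
    -- `1`.
    simp only [ENNReal.toReal_top, inv_zero, Real.rpow_zero, one_smul]
    exact Real.iSup_le (hx rfl) zero_le_one
  · have h0 := ENNReal.toReal_pos hq0 hqt
    obtain ⟨f, hf, h⟩ := exists_mem_powerClass_weakNorm_le hq hqt
      fun i => w i ^ q.toReal⁻¹ • x i
    refine ⟨f, hf, ?_⟩
    rw [Real.le_rpow_inv_iff_of_pos (weakNorm_nonneg hq0 _)
      (Finset.sum_nonneg fun i _ => mul_nonneg (hw i) (hf.1 _)) h0]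
    refine h.trans_eq (Finset.sum_congr rfl fun i _ => ?_)
    rw [hf.2.1, abs_of_nonneg (Real.rpow_nonneg (hw i) _), Real.rpow_inv_rpow (hw i) h0.ne']

end PowerClass

/-! ### Pietsch domination on cones. -/

section Domination

variable {m : ℕ} {E : Fin m → Type*} [∀ j, NormedAddCommGroup (E j)] [∀ j, NormedSpace ℝ (E j)]
  {F : Type*} [NormedAddCommGroup F] [NormedSpace ℝ F]

theorem apply_smul_smul (T : ContinuousMultilinearMap ℝ E F) (c : Fin m → ℝ) (d : ℝ)
    (x : ∀ j, E j) (y : StrongDual ℝ F) :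
    (d • y) (T fun j => c j • x j) = d * (∏ j, c j) * y (T x) := by
  rw [T.map_smul_univ]
  simp only [smul_apply, map_smul, smul_eq_mul]
  ring

theorem sum_inv_toReal {p r : ℝ≥0∞} {q : Fin m → ℝ≥0∞} (hr : 1 ≤ r)
    (hq : ∀ j, 1 ≤ q j) (hpqr : p⁻¹ = (∑ j, (q j)⁻¹) + r⁻¹) :
    (∑ j, (q j).toReal⁻¹) + r.toReal⁻¹ = p.toReal⁻¹ := by
  have hq' : ∀ j, (q j)⁻¹ ≠ ∞ := fun j => ENNReal.inv_ne_top.2 (zero_lt_one.trans_le (hq j)).ne'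
  have h := congrArg ENNReal.toReal hpqr
  rw [ENNReal.toReal_add (ENNReal.sum_ne_top.2 fun j _ => hq' j)
    (ENNReal.inv_ne_top.2 (zero_lt_one.trans_le hr).ne'), ENNReal.toReal_sum fun j _ => hq' j] at h
  simpa only [ENNReal.toReal_inv] using h.symm

/-- Weighted AM-GM. It replaces the product by an expression linear in the factors, as the
separation argument requires. -/
theorem prod_rpow_mul_rpow_le {P b : ℝ} {a W : Fin m → ℝ} {W' : ℝ} (hP : 0 ≤ P)
    (ha : ∀ j, 0 ≤ a j) (hb : 0 ≤ b) (hsum : (∑ j, P * a j) + P * b = 1) (hW : ∀ j, 0 ≤ W j)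
    (hW' : 0 ≤ W') :
    ((∏ j, W j ^ a j) * W' ^ b) ^ P ≤ (∑ j, P * a j * W j) + P * b * W' := by
  have h1 : 0 ≤ ∏ j, W j ^ a j := Finset.prod_nonneg fun j _ => Real.rpow_nonneg (hW j) _
  have h := Real.geom_mean_le_arith_mean_weighted (Finset.univ : Finset (Option (Fin m)))
    (fun o => o.elim (P * b) fun j => P * a j) (fun o => o.elim W' W)
    (by
      rintro (_ | j) -
      exacts [mul_nonneg hP hb, mul_nonneg hP (ha j)])
    (by rw [Fintype.sum_option, add_comm]; exact hsum)
    (by rintro (_ | j) -; exacts [hW', hW j])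
  rw [Fintype.sum_option, Fintype.prod_option] at h
  simp only [Option.elim] at h
  rw [Real.mul_rpow h1 (Real.rpow_nonneg hW' _),
    ← Real.finsetProd_rpow _ _ fun j _ => Real.rpow_nonneg (hW j) _, ← Real.rpow_mul hW',
    mul_comm b P]
  simp only [← Real.rpow_mul (hW _), mul_comm _ P]
  linarith

/-- The hypothesis is applied to `w_i^{1/q_j} x_i^j` and `w_i^{1/r} y_i`. These scalars multiply to
`w_i^{1/p}`, so the `p`-th powers carry exactly the weights `w_i`. -/
theorem exists_mem_powerClass_sum_le {p r : ℝ≥0∞} {q : Fin m → ℝ≥0∞} (hp : 1 ≤ p) (hpt : p ≠ ∞)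
    (hr : 1 ≤ r) (hq : ∀ j, 1 ≤ q j) (hpqr : p⁻¹ = (∑ j, (q j)⁻¹) + r⁻¹)
    (T : ContinuousMultilinearMap ℝ E F)
    {D : ∀ j, Set (E j)} {D' : Set (StrongDual ℝ F)}
    (hD : ∀ j (t : ℝ), 0 ≤ t → ∀ x ∈ D j, t • x ∈ D j)
    (hD' : ∀ t : ℝ, 0 ≤ t → ∀ y ∈ D', t • y ∈ D') {C : ℝ} (hC : 0 ≤ C)
    (hT : ∀ (n : ℕ) (x : Fin n → ∀ j, E j) (y : Fin n → StrongDual ℝ F),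
      (∀ i j, x i j ∈ D j) → (∀ i, y i ∈ D') →
        strongNorm p (fun i => y i (T (x i))) ≤
          C * (∏ j, weakNorm (q j) (fun i => x i j)) * weakNorm r y)
    {n : ℕ} {x : Fin n → ∀ j, E j} {y : Fin n → StrongDual ℝ F} {w : Fin n → ℝ}
    (hw : ∀ i, 0 ≤ w i) (hx : ∀ i j, x i j ∈ D j) (hy : ∀ i, y i ∈ D')
    (hx' : ∀ j, q j = ∞ → ∀ i, ‖x i j‖ ≤ 1) (hy' : r = ∞ → ∀ i, ‖y i‖ ≤ 1) :
    ∃ f : ∀ j, E j → ℝ, ∃ g : StrongDual ℝ F → ℝ, (∀ j, f j ∈ powerClass (E j) (q j)) ∧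
      g ∈ powerClass (StrongDual ℝ F) r ∧ ∑ i, w i * |y i (T (x i))| ^ p.toReal ≤
        ∑ i, w i * (C ^ p.toReal * ((∑ j, p.toReal * (q j).toReal⁻¹ * f j (x i j)) +
          p.toReal * r.toReal⁻¹ * g (y i))) := by
  have hp0 : p ≠ 0 := (zero_lt_one.trans_le hp).ne'
  have hr0 : r ≠ 0 := (zero_lt_one.trans_le hr).ne'
  have hq0 : ∀ j, q j ≠ 0 := fun j => (zero_lt_one.trans_le (hq j)).ne'
  have hP0 : 0 < p.toReal := ENNReal.toReal_pos hp0 hpt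
  have hsum := sum_inv_toReal hr hq hpqr
  have hsum' : (∑ j, p.toReal * (q j).toReal⁻¹) + p.toReal * r.toReal⁻¹ = 1 := by
    rw [← Finset.mul_sum, ← mul_add, hsum, mul_inv_cancel₀ hP0.ne']
  have ha : ∀ j, 0 ≤ (q j).toReal⁻¹ := fun j => by positivity
  have hb : 0 ≤ r.toReal⁻¹ := by positivity
  choose f hf hfw using fun j => exists_mem_powerClass_weighted (hq j)
    (fun i => x i j) (hx' j) hw
  obtain ⟨g, hg, hgw⟩ := exists_mem_powerClass_weighted hr y hy' hw
  refine ⟨f, g, hf, hg, ?_⟩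
  have hW0 : ∀ j, 0 ≤ ∑ i, w i * f j (x i j) := fun j =>
    Finset.sum_nonneg fun i _ => mul_nonneg (hw i) ((hf j).1 _)
  have hW'0 : 0 ≤ ∑ i, w i * g (y i) := Finset.sum_nonneg fun i _ => mul_nonneg (hw i) (hg.1 _)
  have key := (hT n (fun i j => w i ^ (q j).toReal⁻¹ • x i j) (fun i => w i ^ r.toReal⁻¹ • y i)
    (fun i j => hD j _ (Real.rpow_nonneg (hw i) _) _ (hx i j))
    (fun i => hD' _ (Real.rpow_nonneg (hw i) _) _ (hy i))).trans
    (mul_le_mul (mul_le_mul_of_nonneg_left (Finset.prod_le_prod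
      (fun j _ => weakNorm_nonneg (hq0 j) _) fun j _ => hfw j) hC) hgw
      (weakNorm_nonneg hr0 _) (mul_nonneg hC (Finset.prod_nonneg fun j _ =>
        Real.rpow_nonneg (hW0 j) _)))
  have hprod : 0 ≤ (∏ j, (∑ i, w i * f j (x i j)) ^ (q j).toReal⁻¹) *
      (∑ i, w i * g (y i)) ^ r.toReal⁻¹ :=
    mul_nonneg (Finset.prod_nonneg fun j _ => Real.rpow_nonneg (hW0 j) _)
      (Real.rpow_nonneg hW'0 _)
  rw [strongNorm_eq_sum hP0, one_div, mul_assoc,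
    Real.rpow_inv_le_iff_of_pos (by positivity) (mul_nonneg hC hprod) hP0,
    Real.mul_rpow hC hprod] at key
  calc ∑ i, w i * |y i (T (x i))| ^ p.toReal
      = ∑ i, ‖(w i ^ r.toReal⁻¹ • y i) (T fun j => w i ^ (q j).toReal⁻¹ • x i j)‖ ^ p.toReal := by
        refine Finset.sum_congr rfl fun i _ => ?_
        rw [apply_smul_smul, ← Real.rpow_sum_of_nonneg (hw i) fun j _ => ha j,
          ← Real.rpow_add_of_nonneg (hw i) hb (Finset.sum_nonneg fun j _ => ha j), add_comm, hsum,
          norm_mul, Real.mul_rpow (norm_nonneg _) (norm_nonneg _),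
          Real.norm_of_nonneg (Real.rpow_nonneg (hw i) _), Real.rpow_inv_rpow (hw i) hP0.ne',
          Real.norm_eq_abs]
    _ ≤ _ := key
    _ ≤ C ^ p.toReal * ((∑ j, p.toReal * (q j).toReal⁻¹ * ∑ i, w i * f j (x i j)) +
          p.toReal * r.toReal⁻¹ * ∑ i, w i * g (y i)) :=
        mul_le_mul_of_nonneg_left (prod_rpow_mul_rpow_le hP0.le ha hb hsum' hW0 hW'0)
          (Real.rpow_nonneg hC _)
    _ = _ := by
        simp only [Finset.mul_sum, mul_add, Finset.sum_add_distrib]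
        rw [Finset.sum_comm]
        congr 1
        · exact Finset.sum_congr rfl fun i _ => Finset.sum_congr rfl fun j _ => by ring
        · exact Finset.sum_congr rfl fun i _ => by ring

/-- Ky Fan's lemma makes `(f, g)` independent of the family. A variable with exponent `∞` has
coefficient `0` in the sum and is controlled by the unit-ball constraint instead. -/
theorem exists_mem_powerClass_forall_le {p r : ℝ≥0∞} {q : Fin m → ℝ≥0∞} (hp : 1 ≤ p)
    (hpt : p ≠ ∞) (hr : 1 ≤ r) (hq : ∀ j, 1 ≤ q j) (hpqr : p⁻¹ = (∑ j, (q j)⁻¹) + r⁻¹)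
    (T : ContinuousMultilinearMap ℝ E F)
    {D : ∀ j, Set (E j)} {D' : Set (StrongDual ℝ F)}
    (hD : ∀ j (t : ℝ), 0 ≤ t → ∀ x ∈ D j, t • x ∈ D j)
    (hD' : ∀ t : ℝ, 0 ≤ t → ∀ y ∈ D', t • y ∈ D') {C : ℝ} (hC : 0 ≤ C)
    (hT : ∀ (n : ℕ) (x : Fin n → ∀ j, E j) (y : Fin n → StrongDual ℝ F),
      (∀ i j, x i j ∈ D j) → (∀ i, y i ∈ D') →
        strongNorm p (fun i => y i (T (x i))) ≤
          C * (∏ j, weakNorm (q j) (fun i => x i j)) * weakNorm r y) :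
    ∃ f : ∀ j, E j → ℝ, ∃ g : StrongDual ℝ F → ℝ, (∀ j, f j ∈ powerClass (E j) (q j)) ∧
      g ∈ powerClass (StrongDual ℝ F) r ∧ ∀ x y, (∀ j, x j ∈ D j) → y ∈ D' →
        (∀ j, q j = ∞ → ‖x j‖ ≤ 1) → (r = ∞ → ‖y‖ ≤ 1) →
        |y (T x)| ^ p.toReal ≤ C ^ p.toReal * ((∑ j, p.toReal * (q j).toReal⁻¹ * f j (x j)) +
          p.toReal * r.toReal⁻¹ * g y) := by
  let Ω := {ω : (∀ j, E j) × StrongDual ℝ F // ((∀ j, ω.1 j ∈ D j) ∧ ω.2 ∈ D') ∧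
    (∀ j, q j = ∞ → ‖ω.1 j‖ ≤ 1) ∧ (r = ∞ → ‖ω.2‖ ≤ 1)}
  let L : ((∀ j, E j → ℝ) × (StrongDual ℝ F → ℝ)) → Ω → ℝ := fun f ω =>
    C ^ p.toReal * ((∑ j, p.toReal * (q j).toReal⁻¹ * f.1 j (ω.1.1 j)) +
      p.toReal * r.toReal⁻¹ * f.2 ω.1.2)
  have hL : IsLinearMap ℝ L := by
    refine ⟨fun f g => funext fun ω => ?_, fun c f => funext fun ω => ?_⟩
    · simp only [L, Prod.fst_add, Prod.snd_add, Pi.add_apply, mul_add, Finset.sum_add_distrib]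
      ring
    · simp only [L, Prod.smul_fst, Prod.smul_snd, Pi.smul_apply, smul_eq_mul, mul_add,
        Finset.mul_sum]
      congr 1
      · exact Finset.sum_congr rfl fun j _ => by ring
      · ring
  have hLc : Continuous L := continuous_pi fun ω => by
    refine continuous_const.mul ((continuous_finsetSum _ fun j _ => ?_).add ?_)
    · exact continuous_const.mul
        ((continuous_apply (ω.1.1 j)).comp ((continuous_apply j).comp continuous_fst))
    · exact continuous_const.mul ((continuous_apply ω.1.2).comp continuous_snd)
  have hK : IsCompact ((Set.univ.pi fun j => powerClass (E j) (q j)) ×ˢ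
      powerClass (StrongDual ℝ F) r) :=
    (isCompact_univ_pi fun j => isCompact_powerClass).prod isCompact_powerClass
  have hKc : Convex ℝ ((Set.univ.pi fun j => powerClass (E j) (q j)) ×ˢ
      powerClass (StrongDual ℝ F) r) :=
    (convex_pi fun j _ => convex_powerClass).prod convex_powerClass
  obtain ⟨_, ⟨⟨f, g⟩, ⟨hf, hg⟩, rfl⟩, hle⟩ := exists_forall_le_of_weighted
    (hK.image hLc) (hKc.is_linear_image hL)
    (fun ω => |ω.1.2 (T ω.1.1)| ^ p.toReal) (by
      intro n ω w hw
      obtain ⟨f, g, hf, hg, h⟩ := exists_mem_powerClass_sum_le hp hpt hr hq hpqr T hD hD' hC hT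
        (x := fun i => (ω i).1.1) (y := fun i => (ω i).1.2) hw (fun i => (ω i).2.1.1)
        (fun i => (ω i).2.1.2) (fun j h i => (ω i).2.2.1 j h) (fun h i => (ω i).2.2.2 h)
      exact ⟨L (f, g), ⟨(f, g), ⟨fun j _ => hf j, hg⟩, rfl⟩, h⟩)
  exact ⟨f, g, fun j => hf j (Set.mem_univ j), hg, fun x y hx hy hx' hy' =>
    hle ⟨(x, y), ⟨hx, hy⟩, hx', hy'⟩⟩

/-- Pietsch's domination theorem for multilinear maps restricted to cones. -/
theorem exists_dominating_seminorms {p r : ℝ≥0∞} {q : Fin m → ℝ≥0∞} (hp : 1 ≤ p) (hr : 1 ≤ r)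
    (hq : ∀ j, 1 ≤ q j) (hpqr : p⁻¹ = (∑ j, (q j)⁻¹) + r⁻¹) (T : ContinuousMultilinearMap ℝ E F)
    {D : ∀ j, Set (E j)} {D' : Set (StrongDual ℝ F)}
    (hD : ∀ j (t : ℝ), 0 ≤ t → ∀ x ∈ D j, t • x ∈ D j)
    (hD' : ∀ t : ℝ, 0 ≤ t → ∀ y ∈ D', t • y ∈ D') {C : ℝ} (hC : 0 ≤ C)
    (hT : ∀ (n : ℕ) (x : Fin n → ∀ j, E j) (y : Fin n → StrongDual ℝ F),
      (∀ i j, x i j ∈ D j) → (∀ i, y i ∈ D') →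
        strongNorm p (fun i => y i (T (x i))) ≤
          C * (∏ j, weakNorm (q j) (fun i => x i j)) * weakNorm r y) :
    ∃ (N : ∀ j, Seminorm ℝ (E j)) (M : Seminorm ℝ (StrongDual ℝ F)),
      (∀ j, WeaklyBounded (q j) (N j)) ∧ WeaklyBounded r M ∧
      ∀ x y, (∀ j, x j ∈ D j) → y ∈ D' → |y (T x)| ≤ C * (∏ j, N j (x j)) * M y := by
  have hp0 : p ≠ 0 := (zero_lt_one.trans_le hp).ne'
  have hr0 : r ≠ 0 := (zero_lt_one.trans_le hr).ne'
  have hq0 : ∀ j, q j ≠ 0 := fun j => (zero_lt_one.trans_le (hq j)).ne'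
  rcases eq_or_ne p ∞ with rfl | hpt
  -- If `p = ∞`, all exponents are infinite and one-term families give the claim with the norms as
  -- seminorms.
  · have h := hpqr.symm
    rw [ENNReal.inv_top, add_eq_zero, Finset.sum_eq_zero_iff, ENNReal.inv_eq_zero] at h
    obtain ⟨hqt, rfl⟩ := h
    have hqt : ∀ j, q j = ∞ := fun j => ENNReal.inv_eq_zero.1 (hqt j (Finset.mem_univ j))
    refine ⟨fun j => normSeminorm ℝ (E j), normSeminorm ℝ _, fun j => ?_,
      weaklyBounded_normSeminorm, fun x y hx hy => ?_⟩
    · rw [hqt j]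
      exact weaklyBounded_normSeminorm
    · have h := hT 1 (fun _ => x) (fun _ => y) (fun _ => hx) (fun _ => hy)
      rw [strongNorm_fin_one hp0] at h
      refine h.trans ?_
      exact mul_le_mul (mul_le_mul_of_nonneg_left (Finset.prod_le_prod
        (fun j _ => weakNorm_nonneg (hq0 j) _) fun j _ => weakNorm_fin_one_le (hq0 j) (x j)) hC)
        (weakNorm_fin_one_le hr0 y) (weakNorm_nonneg hr0 _)
        (mul_nonneg hC (Finset.prod_nonneg fun j _ => norm_nonneg _))
  have hP0 : 0 < p.toReal := ENNReal.toReal_pos hp0 hpt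
  have hsum' : (∑ j, p.toReal * (q j).toReal⁻¹) + p.toReal * r.toReal⁻¹ = 1 := by
    rw [← Finset.mul_sum, ← mul_add, sum_inv_toReal hr hq hpqr, mul_inv_cancel₀ hP0.ne']
  obtain ⟨f, g, hf, hg, hle⟩ := exists_mem_powerClass_forall_le hp hpt hr hq hpqr T hD hD' hC hT
  choose N hN hNf using fun j => exists_seminorm_of_mem_powerClass (hq j) (hf j)
  obtain ⟨M, hM, hMg⟩ := exists_seminorm_of_mem_powerClass hr hg
  refine ⟨N, M, hN, hM, fun x y hx hy => ?_⟩
  -- Each argument is scaled into the set where its power function is at most `1`. The coefficients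
  -- `p/q_j` and `p/r` sum to `1`, which leaves the constant `C`. Adding `ε` permits vanishing
  -- seminorms.
  have hε : ∀ ε : ℝ, 0 < ε → |y (T x)| ≤ C * (∏ j, (N j (x j) + ε)) * (M y + ε) := by
    intro ε hε
    have hs : ∀ j, 0 < N j (x j) + ε := fun j => add_pos_of_nonneg_of_pos (apply_nonneg _ _) hε
    have ht : 0 < M y + ε := add_pos_of_nonneg_of_pos (apply_nonneg _ _) hε
    have hx' := fun j => hNf j (x j) _ (hs j) (by linarith)
    have hy' := hMg y _ ht (by linarith)
    have h := hle (fun j => (N j (x j) + ε)⁻¹ • x j) ((M y + ε)⁻¹ • y)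
      (fun j => hD j _ (inv_nonneg.2 (hs j).le) _ (hx j))
      (hD' _ (inv_nonneg.2 ht.le) _ hy) (fun j => (hx' j).2) hy'.2
    have h2 : |((M y + ε)⁻¹ • y) (T fun j => (N j (x j) + ε)⁻¹ • x j)| ^ p.toReal ≤
        C ^ p.toReal := by
      refine h.trans (mul_le_of_le_one_right (Real.rpow_nonneg hC _) ?_)
      rw [← hsum']
      refine add_le_add (Finset.sum_le_sum fun j _ => ?_) ?_
      · exact mul_le_of_le_one_right (by positivity) (hx' j).1
      · exact mul_le_of_le_one_right (by positivity) hy'.1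
    have hpos := mul_pos ht (Finset.prod_pos fun j (_ : j ∈ Finset.univ) => hs j)
    rw [Real.rpow_le_rpow_iff (abs_nonneg _) hC hP0, apply_smul_smul, Finset.prod_inv_distrib,
      ← mul_inv, abs_mul, abs_inv, abs_of_pos hpos, inv_mul_le_iff₀ hpos] at h2
    linarith
  have hcont : Continuous fun ε : ℝ => C * (∏ j, (N j (x j) + ε)) * (M y + ε) := by fun_prop
  have hlim := (hcont.tendsto 0).mono_left (nhdsWithin_le_nhds (s := Set.Ioi 0))
  simp only [add_zero] at hlim
  exact ge_of_tendsto hlim (eventually_mem_nhdsWithin.mono hε)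

end Domination

/-! ### Factoring a multilinear map through operators with dense range. -/

section Extension

variable {ι : Type*} {E A X : ι → Type*} {F : Type*} [NormedAddCommGroup F] [NormedSpace ℝ F]

section

variable [∀ j, NormedAddCommGroup (A j)] [∀ j, NormedSpace ℝ (A j)]
  [∀ j, NormedAddCommGroup (X j)] [∀ j, NormedSpace ℝ (X j)]

theorem update_piMap [DecidableEq ι] (e : ∀ j, A j →ₗᵢ[ℝ] X j) (a : ∀ j, A j) (k : ι) (u : A k) :
    Function.update (Pi.map (fun j => e j) a) k (e k u) =
      Pi.map (fun j => e j) (Function.update a k u) := by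
  ext j
  rcases eq_or_ne j k with rfl | hj
  · simp
  · simp [hj]

variable [Fintype ι]

/-- A multilinear map need not be uniformly continuous, but its increments are bounded by `B`, which
depends only on norms. Isometries carry `B` to the larger space, where it tends to `0` on the
diagonal. -/
theorem exists_continuous_extend_of_isometry [CompleteSpace F]
    (f : ContinuousMultilinearMap ℝ A F) (e : ∀ j, A j →ₗᵢ[ℝ] X j) (he : ∀ j, DenseRange (e j)) :
    ∃ g : (∀ j, X j) → F, Continuous g ∧ ∀ a : ∀ j, A j, g (Pi.map (fun j => e j) a) = f a := by
  have di : IsDenseInducing (Pi.map fun j => e j) :=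
    ⟨Topology.IsInducing.piMap fun j => (e j).isometry.isUniformInducing.isInducing,
      DenseRange.piMap he⟩
  have hnorm : ∀ a : ∀ j, A j, ‖Pi.map (fun j => e j) a‖ = ‖a‖ := fun a => by
    simp [Pi.norm_def, Pi.map, (e _).nnnorm_map]
  have hsub : ∀ a b : ∀ j, A j, Pi.map (fun j => e j) a - Pi.map (fun j => e j) b =
      Pi.map (fun j => e j) (a - b) := fun a b => by
    ext j
    simp
  have hlim : ∀ b, ∃ c, Tendsto f (comap (Pi.map fun j => e j) (𝓝 b)) (𝓝 c) := by
    intro b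
    have hne : (comap (Pi.map fun j => e j) (𝓝 b)).NeBot := di.comap_nhds_neBot b
    rw [← cauchy_map_iff_exists_tendsto, cauchy_map_iff, tendsto_uniformity_iff_dist_tendsto_zero]
    refine ⟨hne, ?_⟩
    let B : (∀ j, X j) × (∀ j, X j) → ℝ := fun w => ‖f‖ * Fintype.card ι *
      max ‖w.1‖ ‖w.2‖ ^ (Fintype.card ι - 1) * ‖w.1 - w.2‖
    have hB : Tendsto B (𝓝 (b, b)) (𝓝 0) := by
      have hBc : Continuous B := by fun_prop
      simpa [B] using hBc.tendsto (b, b)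
    have hBe : Tendsto (fun p : (∀ j, A j) × (∀ j, A j) =>
        B (Pi.map (fun j => e j) p.1, Pi.map (fun j => e j) p.2))
        (comap (Pi.map fun j => e j) (𝓝 b) ×ˢ comap (Pi.map fun j => e j) (𝓝 b)) (𝓝 0) := by
      refine hB.comp ?_
      rw [nhds_prod_eq]
      exact tendsto_comap.prodMap tendsto_comap
    refine squeeze_zero (fun _ => dist_nonneg) (fun p => ?_) hBe
    simp only [B, hsub, hnorm, dist_eq_norm]
    exact f.norm_image_sub_le p.1 p.2
  exact ⟨di.extend f, di.continuous_extend hlim, di.extend_eq f.cont⟩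

/-- A continuous multilinear map extends along dense isometric embeddings. -/
theorem exists_multilinear_extend_of_isometry [CompleteSpace F]
    (f : ContinuousMultilinearMap ℝ A F) (e : ∀ j, A j →ₗᵢ[ℝ] X j) (he : ∀ j, DenseRange (e j)) :
    ∃ S : ContinuousMultilinearMap ℝ X F, ∀ a : ∀ j, A j, S (fun j => e j (a j)) = f a := by
  classical
  obtain ⟨g, hg, hgf⟩ := exists_continuous_extend_of_isometry f e he
  have hd : DenseRange (Pi.map fun j => e j) := DenseRange.piMap he
  have hadd : ∀ (z : ∀ j, X j) (k : ι) (u v : X k), g (Function.update z k (u + v)) =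
      g (Function.update z k u) + g (Function.update z k v) := by
    intro z k u v
    refine isClosed_property (hd.prodMap ((he k).prodMap (he k)))
      (p := fun w => g (Function.update w.1 k (w.2.1 + w.2.2)) =
        g (Function.update w.1 k w.2.1) + g (Function.update w.1 k w.2.2))
      (isClosed_eq ?_ ?_) ?_ (z, u, v)
    · exact hg.comp (continuous_fst.update k
        ((continuous_fst.comp continuous_snd).add (continuous_snd.comp continuous_snd)))
    · exact (hg.comp (continuous_fst.update k (continuous_fst.comp continuous_snd))).add
        (hg.comp (continuous_fst.update k (continuous_snd.comp continuous_snd)))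
    · rintro ⟨a, u, v⟩
      simp only [Prod.map, ← map_add, update_piMap, hgf, f.map_update_add]
  have hsmul : ∀ (z : ∀ j, X j) (k : ι) (c : ℝ) (u : X k), g (Function.update z k (c • u)) =
      c • g (Function.update z k u) := by
    intro z k c u
    refine isClosed_property (hd.prodMap (he k))
      (p := fun w => g (Function.update w.1 k (c • w.2)) = c • g (Function.update w.1 k w.2))
      (isClosed_eq ?_ ?_) ?_ (z, u)
    · exact hg.comp (continuous_fst.update k (continuous_snd.const_smul c))
    · exact (hg.comp (continuous_fst.update k continuous_snd)).const_smul c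
    · rintro ⟨a, u⟩
      simp only [Prod.map, ← map_smul, update_piMap, hgf, f.map_update_smul]
  exact ⟨⟨MultilinearMap.mk' g hadd hsmul, hg⟩, hgf⟩

end

variable [Fintype ι] [∀ j, NormedAddCommGroup (E j)] [∀ j, NormedSpace ℝ (E j)]
  [∀ j, NormedAddCommGroup (X j)] [∀ j, NormedSpace ℝ (X j)]

/-- Replacing one coordinate at a time, the difference is `T` at a point where one factor `‖R j _‖`
vanishes. -/
theorem eq_of_forall_apply_eq {T : ContinuousMultilinearMap ℝ E F} {R : ∀ j, E j →L[ℝ] X j}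
    {K : ℝ} (hT : ∀ x, ‖T x‖ ≤ K * ∏ j, ‖R j (x j)‖) {x x' : ∀ j, E j}
    (h : ∀ j, R j (x j) = R j (x' j)) : T x = T x' := by
  classical
  suffices hs : ∀ s : Finset ι, T (s.piecewise x x') = T x' by simpa using hs Finset.univ
  intro s
  induction s using Finset.induction_on with
  | empty => simp
  | insert j s hj ih =>
    rw [Finset.piecewise_insert, ← ih]
    conv_rhs => rw [← Function.update_eq_self j (s.piecewise x x')]
    rw [← sub_eq_zero, ← T.map_update_sub, ← norm_le_zero_iff]
    refine (hT _).trans_eq ?_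
    rw [Finset.prod_eq_zero (Finset.mem_univ j), mul_zero]
    simp [hj, h j]

/-- A multilinear map dominated by operators with dense range factors through them. -/
theorem exists_multilinear_factor [CompleteSpace F] {T : ContinuousMultilinearMap ℝ E F}
    {R : ∀ j, E j →L[ℝ] X j} (hR : ∀ j, DenseRange (R j)) {K : ℝ}
    (hT : ∀ x, ‖T x‖ ≤ K * ∏ j, ‖R j (x j)‖) :
    ∃ S : ContinuousMultilinearMap ℝ X F, T = S.compContinuousLinearMap R := by
  -- The linear sections need not be continuous; the bound `hT` makes `T ∘ σ` continuous for the
  -- norms of the ranges.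
  choose σ hσ using fun j => LinearMap.exists_rightInverse_of_surjective
    (R j : E j →ₗ[ℝ] X j).rangeRestrict (LinearMap.range_rangeRestrict _)
  have hσ' : ∀ j (a : LinearMap.range (R j : E j →ₗ[ℝ] X j)), R j (σ j a) = a := fun j a =>
    congrArg Subtype.val (LinearMap.congr_fun (hσ j) a)
  let f : ContinuousMultilinearMap ℝ (fun j => LinearMap.range (R j : E j →ₗ[ℝ] X j)) F :=
    (T.toMultilinearMap.compLinearMap σ).mkContinuous K fun a => by
      refine (hT _).trans_eq ?_
      simp [hσ']
  obtain ⟨S, hS⟩ := exists_multilinear_extend_of_isometry f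
    (fun j => (LinearMap.range (R j : E j →ₗ[ℝ] X j)).subtypeₗᵢ) fun j => by
      refine (hR j).mono ?_
      rintro _ ⟨x, rfl⟩
      exact ⟨⟨R j x, x, rfl⟩, rfl⟩
  refine ⟨S, ContinuousMultilinearMap.ext fun x => ?_⟩
  have h := hS fun j => ⟨R j (x j), x j, rfl⟩
  refine Eq.trans ?_ h.symm
  exact eq_of_forall_apply_eq hT fun j => (hσ' j ⟨R j (x j), x j, rfl⟩).symm

end Extension

/-! ### Positive functionals on a normed lattice. -/

section Cone

variable {E : Type*} [NormedAddCommGroup E] [Lattice E] [IsOrderedAddMonoid E]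

theorem abs_apply_le_posPart_add_negPart [NormedSpace ℝ E] (L : E →ₗ[ℝ] ℝ) (x : E) :
    |L x| ≤ |L x⁺| + |L x⁻| := by
  conv_lhs => rw [← posPart_sub_negPart x, map_sub]
  exact abs_sub _ _

variable [HasSolidNorm E]

theorem norm_posPart_le (x : E) : ‖x⁺‖ ≤ ‖x‖ :=
  HasSolidNorm.solid (by
    rw [abs_of_nonneg (posPart_nonneg x)]
    exact sup_le (le_abs_self x) (abs_nonneg x))

theorem norm_negPart_le (x : E) : ‖x⁻‖ ≤ ‖x‖ := by
  rw [← posPart_neg, ← norm_neg x]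
  exact norm_posPart_le _

variable [NormedSpace ℝ E] [IsOrderedModule ℝ E]

/-- The norm of the positive part of an element is attained at a positive functional. -/
theorem exists_mem_dualCone_apply_eq (z : E) :
    ∃ y ∈ dualCone E, ‖y‖ ≤ 1 ∧ y z = ‖z⁺‖ := by
  have hsub : ∀ x y : E, ‖(x + y)⁺‖ ≤ ‖x⁺‖ + ‖y⁺‖ := fun x y => by
    refine (HasSolidNorm.solid ?_).trans (norm_add_le _ _)
    rw [abs_of_nonneg (posPart_nonneg _), abs_of_nonneg
      (add_nonneg (posPart_nonneg x) (posPart_nonneg y))]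
    exact sup_le (add_le_add (le_posPart x) (le_posPart y))
      (add_nonneg (posPart_nonneg x) (posPart_nonneg y))
  have hsmul : ∀ c : ℝ, 0 < c → ∀ x : E, ‖(c • x)⁺‖ = c * ‖x⁺‖ := fun c hc x => by
    have : (c • x)⁺ = c • x⁺ := by
      have h : c • (x ⊔ 0) = c • x ⊔ c • 0 := (OrderIso.smulRight hc : E ≃o E).map_sup x 0
      rw [posPart_def, posPart_def, h, smul_zero]
    rw [this, norm_smul, Real.norm_of_nonneg hc.le]
  have hle : ∀ c : ℝ, c * ‖z⁺‖ ≤ ‖(c • z)⁺‖ := fun c => by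
    rcases le_or_gt c 0 with hc | hc
    · exact (mul_nonpos_of_nonpos_of_nonneg hc (norm_nonneg _)).trans (norm_nonneg _)
    · exact (hsmul c hc z).ge
  -- Hahn–Banach with the sublinear functional `‖x⁺‖`. Domination by it forces positivity, since
  -- `(-x)⁺ = 0` for `x ≥ 0`.
  obtain ⟨g, hg, hgN⟩ := exists_extension_of_le_sublinear
    (LinearPMap.mkSpanSingleton' (σ := RingHom.id ℝ) z ‖z⁺‖ fun c hc => by
      rcases smul_eq_zero.1 hc with rfl | rfl <;> simp) (fun x => ‖x⁺‖) hsmul hsub (by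
    rintro ⟨x, hx⟩
    obtain ⟨c, rfl⟩ := Submodule.mem_span_singleton.1 hx
    rw [LinearPMap.mkSpanSingleton'_apply]
    exact hle c)
  have hgz : g z = ‖z⁺‖ := by
    have := hg ⟨z, Submodule.mem_span_singleton_self z⟩
    exact this.trans (LinearPMap.mkSpanSingleton'_apply_self _ _ _ _)
  have hgb : ∀ x, ‖g x‖ ≤ 1 * ‖x‖ := fun x => by
    rw [one_mul, Real.norm_eq_abs, abs_le']
    refine ⟨(hgN x).trans (norm_posPart_le x), ?_⟩
    rw [← map_neg, ← norm_neg x]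
    exact (hgN _).trans (norm_posPart_le _)
  refine ⟨g.mkContinuous 1 hgb, fun x hx => ?_, g.mkContinuous_norm_le zero_le_one hgb, hgz⟩
  have h := hgN (-x)
  rw [posPart_eq_zero.2 (neg_nonpos.2 hx), norm_zero, map_neg] at h
  exact neg_nonpos.1 h

/-- One positive functional norms `z⁺` and another `z⁻`; the `2` is the triangle inequality for `z =
z⁺ - z⁻`. -/
theorem norm_le_of_forall_mem_dualCone {z : E} {B : ℝ}
    (h : ∀ y ∈ dualCone E, ‖y‖ ≤ 1 → |y z| ≤ B) : ‖z‖ ≤ 2 * B := by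
  obtain ⟨y, hy, hy1, hyz⟩ := exists_mem_dualCone_apply_eq z
  obtain ⟨y', hy', hy1', hyz'⟩ := exists_mem_dualCone_apply_eq (-z)
  have h1 := h y hy hy1
  have h2 := h y' hy' hy1'
  rw [hyz, abs_of_nonneg (norm_nonneg _)] at h1
  rw [map_neg] at hyz'
  rw [← abs_neg, hyz', abs_of_nonneg (norm_nonneg _), posPart_neg] at h2
  calc ‖z‖ = ‖z⁺ - z⁻‖ := by rw [posPart_sub_negPart]
    _ ≤ _ := norm_sub_le _ _
    _ ≤ _ := by linarith

end Cone

/-! ### The space through which each variable factors. -/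

section FactorSpace

variable {E : Type u} [NormedAddCommGroup E] [NormedSpace ℝ E] [Lattice E]
  [IsOrderedAddMonoid E] [HasSolidNorm E]

theorem abs_apply_le_mul_of_cone {N : Seminorm ℝ E} (hN : ∀ x, N x ≤ ‖x‖) {c : ℝ} (hc : 0 ≤ c)
    {L : E →ₗ[ℝ] ℝ} (hL : ∀ u, 0 ≤ u → |L u| ≤ c * N u) (x : E) : |L x| ≤ c * (2 * ‖x‖) := by
  have h1 := (hN x⁺).trans (norm_posPart_le x)
  have h2 := (hN x⁻).trans (norm_negPart_le x)
  calc |L x| ≤ c * N x⁺ + c * N x⁻ := (abs_apply_le_posPart_add_negPart L x).trans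
        (add_le_add (hL _ (posPart_nonneg x)) (hL _ (negPart_nonneg x)))
    _ = c * (N x⁺ + N x⁻) := by ring
    _ ≤ _ := mul_le_mul_of_nonneg_left (by linarith) hc

/-- The Banach space attached to a seminorm `N` on a Banach lattice: its norm is the largest one
that is dominated by `N` on the positive cone. -/
theorem exists_factor_space (N : Seminorm ℝ E) (hN : ∀ x, N x ≤ ‖x‖) :
    ∃ (X : Type (max u w)) (_ : NormedAddCommGroup X) (_ : NormedSpace ℝ X) (_ : CompleteSpace X)
      (R : E →L[ℝ] X), DenseRange R ∧ (∀ u, 0 ≤ u → ‖R u‖ ≤ N u) ∧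
      ∀ (L : E →ₗ[ℝ] ℝ) (c : ℝ), 0 ≤ c → (∀ u, 0 ≤ u → |L u| ≤ c * N u) →
        ∀ x, |L x| ≤ c * ‖R x‖ := by
  -- `E` is mapped into `ℓ_∞(I)` by evaluation, and the space is the closure of the image. The lift
  -- only adjusts the universe.
  let I := ULift.{w} {L : E →ₗ[ℝ] ℝ // ∀ u, 0 ≤ u → |L u| ≤ N u}
  have hI : ∀ (L : I) (x : E), ‖L.down.1 x‖ ≤ 2 * ‖x‖ := fun L x => by
    simpa using abs_apply_le_mul_of_cone hN zero_le_one (fun u hu => by simpa using L.down.2 u hu) x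
  let R₀ : E →ₗ[ℝ] lp (fun _ : I => ℝ) ∞ :=
    { toFun := fun x => ⟨fun L => L.down.1 x, memℓp_infty ⟨2 * ‖x‖, by
        rintro _ ⟨L, rfl⟩
        exact hI L x⟩⟩
      map_add' := fun x y => by ext L; exact map_add L.down.1 x y
      map_smul' := fun c x => by ext L; exact map_smul L.down.1 c x }
  let R₁ : E →L[ℝ] lp (fun _ : I => ℝ) ∞ := R₀.mkContinuous 2 fun x =>
    lp.norm_le_of_forall_le (by positivity) fun L => hI L x
  let Y := (LinearMap.range (R₁ : E →ₗ[ℝ] lp (fun _ : I => ℝ) ∞)).topologicalClosure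
  have hY : ∀ x, R₁ x ∈ Y := fun x => Submodule.le_topologicalClosure _ ⟨x, rfl⟩
  refine ⟨Y, inferInstance, inferInstance,
    (Submodule.isClosed_topologicalClosure _).completeSpace_coe, R₁.codRestrict Y hY, ?_, ?_, ?_⟩
  · rw [DenseRange, Subtype.dense_iff]
    intro z hz
    rw [← Set.range_comp]
    exact hz
  · exact fun u hu => lp.norm_le_of_forall_le (apply_nonneg N u) fun L => L.down.2 u hu
  · intro L c hc hL x
    rcases hc.eq_or_lt with rfl | hc
    · have h := abs_apply_le_mul_of_cone hN le_rfl hL x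
      rwa [zero_mul] at h ⊢
    -- For `c > 0` the functional `c⁻¹ • L` is itself one of the coordinates of `R₁`.
    · have hL' : ∀ u, 0 ≤ u → |(c⁻¹ • L) u| ≤ N u := fun u hu => by
        rw [LinearMap.smul_apply, smul_eq_mul, abs_mul, abs_of_pos (inv_pos.2 hc),
          inv_mul_le_iff₀ hc]
        exact hL u hu
      have h := lp.norm_apply_le_norm ENNReal.top_ne_zero (R₁ x) (ULift.up ⟨c⁻¹ • L, hL'⟩)
      change |(c⁻¹ • L) x| ≤ ‖R₁ x‖ at h
      rw [LinearMap.smul_apply, smul_eq_mul, abs_mul, abs_of_pos (inv_pos.2 hc),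
        inv_mul_le_iff₀ hc] at h
      exact h

end FactorSpace

/-! ### The two directions of the factorization. -/

section Factorization

variable {m : ℕ} {F : Type v} [NormedAddCommGroup F] [NormedSpace ℝ F] [Lattice F]

section

variable {E : Fin m → Type u} [∀ j, NormedAddCommGroup (E j)] [∀ j, NormedSpace ℝ (E j)]
  [∀ j, Lattice (E j)]
  {X : Fin m → Type*} [∀ j, NormedAddCommGroup (X j)] [∀ j, NormedSpace ℝ (X j)]

theorem abs_apply_le_prod_norm {F : Type*} [NormedAddCommGroup F] [NormedSpace ℝ F]
    {T : ContinuousMultilinearMap ℝ E F} {y : StrongDual ℝ F}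
    {N : ∀ j, Seminorm ℝ (E j)} {R : ∀ j, E j →L[ℝ] X j}
    (hR : ∀ j (L : E j →ₗ[ℝ] ℝ) (c : ℝ), 0 ≤ c → (∀ u, 0 ≤ u → |L u| ≤ c * N j u) →
      ∀ x, |L x| ≤ c * ‖R j x‖) {K : ℝ} (hK : 0 ≤ K)
    (hT : ∀ x, (∀ j, 0 ≤ x j) → |y (T x)| ≤ K * ∏ j, N j (x j)) (x : ∀ j, E j) :
    |y (T x)| ≤ K * ∏ j, ‖R j (x j)‖ := by
  -- `s` is the set of variables already freed from positivity. With the others frozen, `T` followed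
  -- by `y` is a linear functional of the next variable, to which `hR` applies.
  suffices hs : ∀ (s : Finset (Fin m)) (x : ∀ j, E j), (∀ j ∉ s, 0 ≤ x j) →
      |y (T x)| ≤ K * ∏ j, if j ∈ s then ‖R j (x j)‖ else N j (x j) by
    simpa using hs Finset.univ x (by simp)
  intro s
  induction s using Finset.induction_on with
  | empty => simpa using hT
  | insert k s hk ih =>
    intro x hx
    set c := K * ∏ j ∈ Finset.univ.erase k, if j ∈ s then ‖R j (x j)‖ else N j (x j) with hc
    have hc0 : 0 ≤ c := mul_nonneg hK <| Finset.prod_nonneg fun j _ => by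
      split_ifs
      exacts [norm_nonneg _, apply_nonneg _ _]
    have h := hR k (y ∘L T.toContinuousLinearMap x k : E k →L[ℝ] ℝ) c hc0 (fun u hu => by
      refine (ih (Function.update x k u) fun j hj => ?_).trans_eq ?_
      · rcases eq_or_ne j k with rfl | hjk
        · simpa using hu
        · simpa [hjk] using hx j (by simp [hjk, hj])
      · rw [← Finset.mul_prod_erase _ _ (Finset.mem_univ k), hc, mul_assoc,
          mul_comm (∏ j ∈ Finset.univ.erase k, _)]
        simp only [hk, if_false, Function.update_self]
        congr 2
        refine Finset.prod_congr rfl fun j hj => ?_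
        simp [Finset.ne_of_mem_erase hj]) (x k)
    have hy : |y (T (Function.update x k (x k)))| ≤ c * ‖R k (x k)‖ := h
    rw [Function.update_eq_self] at hy
    refine hy.trans_eq ?_
    rw [← Finset.mul_prod_erase _ _ (Finset.mem_univ k), hc, mul_assoc,
      mul_comm (∏ j ∈ Finset.univ.erase k, _)]
    simp only [Finset.mem_insert_self, if_true]
    congr 2
    refine Finset.prod_congr rfl fun j hj => ?_
    simp [Finset.ne_of_mem_erase hj]

/-- Hölder with exponents `r*` and `r`, where `r** = r`. -/
theorem cohenPosBound_of_forall_abs_le {r : ℝ≥0∞} (hr : 1 ≤ r) {S : ContinuousMultilinearMap ℝ X F}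
    {M : Seminorm ℝ (StrongDual ℝ F)} (hM : WeaklyBounded r M) {C : ℝ} (hC : 0 ≤ C)
    (hS : ∀ z, ∀ y ∈ dualCone F, |y (S z)| ≤ C * (∏ j, ‖z j‖) * M y) :
    CohenPosBound r.conjExponent S C := by
  have hrr := ENNReal.HolderConjugate.conjExponent hr
  have hr0 : r ≠ 0 := (zero_lt_one.trans_le hr).ne'
  have hr0' : r.conjExponent ≠ 0 := ENNReal.HolderConjugate.ne_zero _ r
  have := hrr.symm
  intro n x y hy
  rw [ENNReal.HolderConjugate.conjExponent_eq (p := r.conjExponent) (q := r)]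
  calc ∑ i, |y i (S (x i))| ≤ ∑ i, C * ((∏ j, ‖x i j‖) * M (y i)) :=
        Finset.sum_le_sum fun i _ => (hS (x i) (y i) (hy i)).trans_eq (mul_assoc _ _ _)
    _ = C * strongNorm 1 (fun i => (∏ j, ‖x i j‖) * M (y i)) := by
        rw [strongNorm_one, Finset.mul_sum]
        refine Finset.sum_congr rfl fun i _ => ?_
        rw [Real.norm_of_nonneg (mul_nonneg (Finset.prod_nonneg fun j _ => norm_nonneg _)
          (apply_nonneg M _))]
    _ ≤ C * (strongNorm r.conjExponent (fun i => ∏ j, ‖x i j‖) *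
          strongNorm r (fun i => M (y i))) :=
        mul_le_mul_of_nonneg_left (strongNorm_mul_le hr0' hr0 one_ne_zero
          (by rw [inv_one, ENNReal.HolderConjugate.inv_add_inv_eq_one]) _ _) hC
    _ ≤ C * (strongNorm r.conjExponent (fun i => ∏ j, ‖x i j‖) * weakNorm r y) :=
        mul_le_mul_of_nonneg_left (mul_le_mul_of_nonneg_left (hM n y) (strongNorm_nonneg hr0' _))
          hC
    _ = _ := (mul_assoc _ _ _).symm

/-- A composition of positive summing operators with a Cohen positive strongly summing
multilinear operator is positive dominated. -/
theorem posDominatedBound_comp (hm : 0 < m) {p r : ℝ≥0∞} {q : Fin m → ℝ≥0∞} (hp : 1 ≤ p)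
    (hr : 1 ≤ r) (hq : ∀ j, 1 ≤ q j) (hpqr : p⁻¹ = (∑ j, (q j)⁻¹) + r⁻¹)
    {S : ContinuousMultilinearMap ℝ X F} {R : ∀ j, E j →L[ℝ] X j} {C : ℝ} {c : Fin m → ℝ}
    (hC : 0 ≤ C) (hS : CohenPosBound r.conjExponent S C)
    (hR : ∀ j, PosSummingBound (q j) (R j) (c j)) :
    PosDominatedBound p q r (S.compContinuousLinearMap R) (C * ∏ j, c j) := by
  have hrr := ENNReal.HolderConjugate.conjExponent hr
  have hpp := ENNReal.HolderConjugate.conjExponent hp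
  have hrr' := hrr.symm
  have hr0 : r ≠ 0 := (zero_lt_one.trans_le hr).ne'
  have hp0 : p ≠ 0 := (zero_lt_one.trans_le hp).ne'
  have hq0 : ∀ j, q j ≠ 0 := fun j => (zero_lt_one.trans_le (hq j)).ne'
  have hr0' : r.conjExponent ≠ 0 := ENNReal.HolderConjugate.ne_zero _ r
  have hp0' : p.conjExponent ≠ 0 := ENNReal.HolderConjugate.ne_zero _ p
  have hs0 : (∑ j, (q j)⁻¹)⁻¹ ≠ 0 := ENNReal.inv_ne_zero.2
    (ENNReal.sum_ne_top.2 fun j _ => ENNReal.inv_ne_top.2 (hq0 j))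
  -- Both conjugate pairs sum to `1`; cancelling `1/r` is legitimate because it is finite.
  have hexp : r.conjExponent⁻¹ = p.conjExponent⁻¹ + (∑ j, (q j)⁻¹)⁻¹⁻¹ := by
    have h := (ENNReal.HolderConjugate.inv_add_inv_eq_one r r.conjExponent).trans
      (ENNReal.HolderConjugate.inv_add_inv_eq_one p p.conjExponent).symm
    rw [hpqr, add_comm (∑ j, _), add_assoc, ENNReal.add_right_inj (ENNReal.inv_ne_top.2 hr0)] at h
    rw [h, inv_inv, add_comm]
  intro n x y hx hy
  obtain ⟨l, hl0, hl1, hl⟩ := exists_dual_strongNorm (p := p) (p' := p.conjExponent)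
    (fun i => ‖y i (S fun j => R j (x i j))‖) fun i => norm_nonneg _
  rw [strongNorm_norm hp0] at hl
  -- The dual sequence `l` is absorbed by the first variable, which exists since `m > 0`.
  have hS' := hS n (fun i j => (if j = ⟨0, hm⟩ then l i else 1) • R j (x i j)) y hy
  rw [ENNReal.HolderConjugate.conjExponent_eq (p := r.conjExponent) (q := r)] at hS'
  have hsum : ∑ i, l i * ‖y i (S fun j => R j (x i j))‖ =
      ∑ i, |y i (S fun j => (if j = ⟨0, hm⟩ then l i else 1) • R j (x i j))| := by
    refine Finset.sum_congr rfl fun i _ => ?_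
    rw [S.map_smul_univ, Finset.prod_ite_eq', if_pos (Finset.mem_univ _), map_smul, smul_eq_mul,
      abs_mul, abs_of_nonneg (hl0 i), Real.norm_eq_abs]
  have hprod : (fun i => ∏ j, ‖(if j = ⟨0, hm⟩ then l i else 1) • R j (x i j)‖) =
      fun i => l i * ∏ j, ‖R j (x i j)‖ := by
    funext i
    simp only [norm_smul, Finset.prod_mul_distrib]
    congr 1
    simp only [apply_ite norm, norm_one]
    rw [Finset.prod_ite_eq', if_pos (Finset.mem_univ _), Real.norm_of_nonneg (hl0 i)]
  have hstrong : strongNorm r.conjExponent (fun i => l i * ∏ j, ‖R j (x i j)‖) ≤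
      ∏ j, c j * weakNorm (q j) (fun i => x i j) :=
    calc _ ≤ strongNorm p.conjExponent l *
          strongNorm (∑ j, (q j)⁻¹)⁻¹ (fun i => ∏ j, ‖R j (x i j)‖) :=
          strongNorm_mul_le hp0' hs0 hr0' hexp _ _
      _ ≤ strongNorm (∑ j, (q j)⁻¹)⁻¹ (fun i => ∏ j, ‖R j (x i j)‖) :=
          mul_le_of_le_one_left (strongNorm_nonneg hs0 _) hl1
      _ ≤ ∏ j, strongNorm (q j) (fun i => ‖R j (x i j)‖) :=
          strongNorm_prod_le Finset.univ q (fun j _ => hq j) fun j i => ‖R j (x i j)‖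
      _ ≤ _ := Finset.prod_le_prod (fun j _ => strongNorm_nonneg (hq0 j) _) fun j _ => by
          rw [strongNorm_norm (hq0 j)]
          exact hR j n _ fun i => hx i j
  rw [hprod, ← hsum] at hS'
  calc _ ≤ _ := hl
    _ ≤ _ := hS'
    _ ≤ C * (∏ j, c j * weakNorm (q j) (fun i => x i j)) * weakNorm r y :=
        mul_le_mul_of_nonneg_right (mul_le_mul_of_nonneg_left hstrong hC) (weakNorm_nonneg hr0 y)
    _ = _ := by rw [Finset.prod_mul_distrib]; ring

end

variable {E : Fin m → Type u} [∀ j, NormedAddCommGroup (E j)] [∀ j, NormedSpace ℝ (E j)]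
  [∀ j, Lattice (E j)] [∀ j, IsOrderedAddMonoid (E j)] [∀ j, IsOrderedModule ℝ (E j)]
  [∀ j, HasSolidNorm (E j)]
  [CompleteSpace F] [IsOrderedAddMonoid F] [IsOrderedModule ℝ F] [HasSolidNorm F]

/-- A positive dominated multilinear map factors, without loss in the constants, through
positive summing operators and a Cohen positive strongly summing multilinear operator. -/
theorem exists_factorization_of_posDominatedBound {p r : ℝ≥0∞} {q : Fin m → ℝ≥0∞} (hp : 1 ≤ p)
    (hr : 1 ≤ r) (hq : ∀ j, 1 ≤ q j) (hpqr : p⁻¹ = (∑ j, (q j)⁻¹) + r⁻¹)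
    {T : ContinuousMultilinearMap ℝ E F} {C : ℝ} (hC : 0 ≤ C) (hT : PosDominatedBound p q r T C) :
    ∃ (X : Fin m → Type (max u w)) (_ : ∀ j, NormedAddCommGroup (X j))
      (_ : ∀ j, NormedSpace ℝ (X j)) (_ : ∀ j, CompleteSpace (X j))
      (R : ∀ j, E j →L[ℝ] X j) (S : ContinuousMultilinearMap ℝ X F),
      (∀ j, PosSummingBound (q j) (R j) 1) ∧ CohenPosBound r.conjExponent S C ∧
        T = S.compContinuousLinearMap R := by
  have hq0 : ∀ j, q j ≠ 0 := fun j => (zero_lt_one.trans_le (hq j)).ne'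
  obtain ⟨N, M, hN, hM, hNM⟩ := exists_dominating_seminorms hp hr hq hpqr T
    (D := fun j => {x | 0 ≤ x}) (D' := dualCone F) (fun j t ht x hx => smul_nonneg ht hx)
    (fun t ht y hy x hx => mul_nonneg ht (hy x hx)) hC hT
  choose X i1 i2 i3 R hRd hRN hRL using fun j =>
    exists_factor_space.{u, w} (N j) ((hN j).le_norm (hq0 j))
  have hTR : ∀ y ∈ dualCone F, ∀ x, |y (T x)| ≤ C * (∏ j, ‖R j (x j)‖) * M y := fun y hy x => by
    have h := abs_apply_le_prod_norm hRL (mul_nonneg hC (apply_nonneg M y))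
      (T := T) (y := y) (fun x hx => (hNM x y hx hy).trans_eq (by ring)) x
    exact h.trans_eq (by ring)
  -- The constant `2 * C` serves only to produce a continuous `S`. The sharp Cohen constant `C`
  -- comes from `hTR` by density of the ranges.
  obtain ⟨S, hS⟩ := exists_multilinear_factor hRd (T := T) (K := 2 * C) fun x => by
    rw [mul_assoc]
    refine norm_le_of_forall_mem_dualCone fun y hy hy1 => (hTR y hy x).trans ?_
    exact mul_le_of_le_one_right (mul_nonneg hC (Finset.prod_nonneg fun j _ => norm_nonneg _))
      ((hM.le_norm (zero_lt_one.trans_le hr).ne' y).trans hy1)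
  refine ⟨X, i1, i2, i3, R, S, fun j n x hx => ?_, ?_, hS⟩
  · rw [one_mul]
    refine le_trans (strongNorm_mono (hq0 j) fun i => ?_) (hN j n x)
    rw [Real.norm_of_nonneg (apply_nonneg (N j) _)]
    exact hRN j _ (hx i)
  · refine cohenPosBound_of_forall_abs_le hr hM hC fun z y hy => ?_
    refine isClosed_property (DenseRange.piMap hRd)
      (p := fun z => |y (S z)| ≤ C * (∏ j, ‖z j‖) * M y)
      (isClosed_le (y.continuous.comp S.cont).abs (by fun_prop)) (fun x => ?_) z
    have h := hTR y hy x
    rw [hS] at h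
    exact h

end Factorization

/-! ### Equality of the norms and the main theorem. -/

theorem posDominatedNorm_le {m : ℕ} {E : Fin m → Type*} [∀ j, NormedAddCommGroup (E j)]
    [∀ j, NormedSpace ℝ (E j)] [∀ j, Lattice (E j)] {F : Type*} [NormedAddCommGroup F]
    [NormedSpace ℝ F] [Lattice F] {p r : ℝ≥0∞} {q : Fin m → ℝ≥0∞}
    {T : ContinuousMultilinearMap ℝ E F} {C : ℝ} (hC : 0 < C) (hT : PosDominatedBound p q r T C) :
    posDominatedNorm p q r T ≤ C :=
  csInf_le ⟨0, fun _ h => h.1.le⟩ ⟨hC, hT⟩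

theorem posDominatedNorm_le_of_isKwapienFactorization {m : ℕ} (hm : 0 < m) {E : Fin m → Type*}
    [∀ j, NormedAddCommGroup (E j)] [∀ j, NormedSpace ℝ (E j)] [∀ j, Lattice (E j)] {F : Type*}
    [NormedAddCommGroup F] [NormedSpace ℝ F] [Lattice F] {p r : ℝ≥0∞} {q : Fin m → ℝ≥0∞}
    (hp : 1 ≤ p) (hr : 1 ≤ r) (hq : ∀ j, 1 ≤ q j) (hpqr : p⁻¹ = (∑ j, (q j)⁻¹) + r⁻¹)
    {X : Fin m → Type*} [∀ j, NormedAddCommGroup (X j)] [∀ j, NormedSpace ℝ (X j)]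
    {T : ContinuousMultilinearMap ℝ E F} {R : ∀ j, E j →L[ℝ] X j}
    {S : ContinuousMultilinearMap ℝ X F} (h : IsKwapienFactorization q r T R S) :
    posDominatedNorm p q r T ≤
      cohenPosNorm r.conjExponent S * ∏ j, posSummingNorm (q j) (R j) := by
  obtain ⟨hR, hS, rfl⟩ := h
  have hcont : Continuous fun ε : ℝ =>
      (cohenPosNorm r.conjExponent S + ε) * ∏ j, (posSummingNorm (q j) (R j) + ε) := by fun_prop
  have hlim := (hcont.tendsto 0).mono_left (nhdsWithin_le_nhds (s := Set.Ioi 0))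
  simp only [add_zero] at hlim
  -- Admissible constants are taken within `ε` of each infimum, so attainment is not needed; then `ε
  -- → 0`.
  refine ge_of_tendsto hlim (eventually_mem_nhdsWithin.mono fun ε hε => ?_)
  obtain ⟨C, ⟨hC0, hC⟩, hCε⟩ := exists_lt_of_csInf_lt hS (lt_add_of_pos_right _ hε)
  choose c hc hcε using fun j => exists_lt_of_csInf_lt (hR j) (lt_add_of_pos_right _ hε)
  refine (posDominatedNorm_le (mul_pos hC0 (Finset.prod_pos fun j _ => (hc j).1))
    (posDominatedBound_comp hm hp hr hq hpqr hC0.le hC fun j => (hc j).2)).trans ?_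
  exact mul_le_mul hCε.le (Finset.prod_le_prod (fun j _ => (hc j).1.le) fun j _ => (hcε j).le)
    (Finset.prod_nonneg fun j _ => (hc j).1.le) (hC0.trans hCε).le

end PositiveOperators

open PositiveOperators in
theorem mainTheorem1 {m : ℕ} (hm : 0 < m) {E : Fin m → Type u} {F : Type v}
    -- `E j` and `F` are Banach lattices
    [∀ j, NormedAddCommGroup (E j)] [∀ j, NormedSpace ℝ (E j)] [∀ j, CompleteSpace (E j)]
    [∀ j, Lattice (E j)] [∀ j, IsOrderedAddMonoid (E j)] [∀ j, IsOrderedModule ℝ (E j)]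
    [∀ j, HasSolidNorm (E j)]
    [NormedAddCommGroup F] [NormedSpace ℝ F] [CompleteSpace F]
    [Lattice F] [IsOrderedAddMonoid F] [IsOrderedModule ℝ F] [HasSolidNorm F]
    (p r : ENNReal) (q : Fin m → ENNReal) (hp : 1 ≤ p) (hr : 1 ≤ r) (hq : ∀ j, 1 ≤ q j)
    (hpqr : p⁻¹ = (∑ j, (q j)⁻¹) + r⁻¹) (T : ContinuousMultilinearMap ℝ E F) :
    (IsPosDominated p q r T ↔
      ∃ (X : Fin m → Type (max u w)) (_ : ∀ j, NormedAddCommGroup (X j))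
        (_ : ∀ j, NormedSpace ℝ (X j)) (_ : ∀ j, CompleteSpace (X j))
        (R : ∀ j, E j →L[ℝ] X j) (S : ContinuousMultilinearMap ℝ X F),
        IsKwapienFactorization q r T R S) ∧
    (IsPosDominated p q r T →
      IsGLB {c : ℝ |
        ∃ (X : Fin m → Type (max u w)) (_ : ∀ j, NormedAddCommGroup (X j))
          (_ : ∀ j, NormedSpace ℝ (X j)) (_ : ∀ j, CompleteSpace (X j))
          (R : ∀ j, E j →L[ℝ] X j) (S : ContinuousMultilinearMap ℝ X F),
          IsKwapienFactorization q r T R S ∧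
          c = cohenPosNorm r.conjExponent S * ∏ j, posSummingNorm (q j) (R j)}
        (posDominatedNorm p q r T)) := by
  refine ⟨⟨fun ⟨C, hC0, hC⟩ => ?_, fun ⟨X, _, _, _, R, S, hR, ⟨C, hC0, hC⟩, hTS⟩ => ?_⟩,
    fun ⟨C₀, hC₀⟩ => ⟨?_, fun b hb => le_csInf ⟨C₀, hC₀⟩ fun C ⟨hC0, hC⟩ => ?_⟩⟩
  · obtain ⟨X, i1, i2, i3, R, S, hR, hS, hTS⟩ :=
      exists_factorization_of_posDominatedBound.{u, v, w} hp hr hq hpqr hC0.le hC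
    exact ⟨X, i1, i2, i3, R, S, fun j => ⟨1, one_pos, hR j⟩, ⟨C, hC0, hS⟩, hTS⟩
  · choose c hc0 hc using hR
    rw [hTS]
    exact ⟨C * ∏ j, c j, mul_pos hC0 (Finset.prod_pos fun j _ => hc0 j),
      posDominatedBound_comp hm hp hr hq hpqr hC0.le hC hc⟩
  · rintro _ ⟨X, i1, i2, i3, R, S, h, rfl⟩
    exact posDominatedNorm_le_of_isKwapienFactorization hm hp hr hq hpqr h
  · obtain ⟨X, i1, i2, i3, R, S, hR, hS, hTS⟩ :=
      exists_factorization_of_posDominatedBound.{u, v, w} hp hr hq hpqr hC0.le hC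
    refine (hb ⟨X, i1, i2, i3, R, S, ⟨fun j => ⟨1, one_pos, hR j⟩, ⟨C, hC0, hS⟩, hTS⟩, rfl⟩).trans ?_
    -- The factorization built from `C` has all `π⁺(R_j) ≤ 1` and Cohen norm of `S` at most `C`,
    -- hence `b ≤ C`.
    refine (mul_le_of_le_one_right (Real.sInf_nonneg fun _ h => h.1.le) ?_).trans
      (csInf_le ⟨0, fun _ h => h.1.le⟩ ⟨hC0, hS⟩)
    exact Finset.prod_le_one (fun j _ => Real.sInf_nonneg fun _ h => h.1.le) fun j _ =>
      csInf_le ⟨0, fun _ h => h.1.le⟩ ⟨one_pos, hR j⟩
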